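/- **Setting.** For an $m\times n$ real matrix $\Phi$, say that $\Phi$ has the RIP of order $s$ with constant $\delta\in(0,1)$ if $(1-\delta)\|v\|_2^2\le\|\Phi v\|_2^2\le(1+\delta)\|v\|_2^2$ for every $v\in\mathbb R^n$ with at most $s$ nonzero coordinates. The noisy compressive sensing program for $(y,\varepsilon)$ is: minimize $\|x\|_1$ subject to $\|y-\Phi x\|_2\le\varepsilon$. Say that $\beta$ is a noise constant of $\Phi$ (for sparsity $k$) if, whenever $y=\Phi x+z$ with $x$ having at most $k$ nonzero coordinates and $\|z\|_2=\varepsilon$, every solution $x^*$ of the program satisfies $\|x-x^*\|_2\le\beta\varepsilon$. The Gaussian channel maps $w\in\mathbb R^m$ to $w+z$, where $z$ has i.i.d. $\mathcal N(0,N)$ coordinates; its capacity under the power constraint $P$ is $C=\frac12\log_2(1+P/N)$ $(\approx\frac12\log_2(P/N)$ at high SNR$)$. $H_b$ is the binary entropy in bits. A *sparse channel code* with $M$ messages consists of a set $\mathcal C$ (the outer code) of $k$-element subsets of $\{1,\dots,n\}$, a threshold $\tau>0$, and for every message $i$ a vector $X_i\in\mathbb R^n$ whose set of nonzero coordinates (its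 pattern) belongs to $\mathcal C$, such that the codeword $W_i=\Phi X_i$ satisfies $\frac1m\|W_i\|_2^2\le P$. Its receiver works on $y=W_i+z$ as follows. (1) It solves the program $\min\|x\|_1$ subject to $\frac1m\|y-\Phi x\|_2^2\le N$; let $\tilde x$ be the result. (2) From $\tilde x$ alone it finds a pattern $S\in\mathcal C$ that differs from $\{j:|\tilde x_j|\ge\tau\}$ in the least number of coordinates. (3) It applies maximum-likelihood decoding, among the messages with pattern $S$, to the orthogonal projection of $y$ onto the span of the columns of $\Phi$ with index in $S$. Write $CX_{ml}(d)$ for the complexity of a maximum-likelihood decoder in dimension $d$ and $CX_{cs}^{noisy}(m,n)$ for the complexity of the noisy program with an $m\times n$ matrix; the complexity of the receiver is the sum of these charges over its uses of the two modules (step (2) is not charged). $P_e$ is the error probability averaged over equally likely messages. **Theorem.** Let $\delta_3,\delta_4\in(0,1)$ with $\delta_3+3\delta_4<2$. (a) There is a $\beta_0$, depending only on $\delta_3,\delta_4$, such that for all $m,n,k$, $\beta_0$ is a noise constant, for sparsity $k$, of every $m\times n$ matrix with the RIP of order $3k$ with constant $\delta_3$ and of order $4k$ with constant $\delta_4$.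 (b) Let $\alpha_0>0$. There are constants $s_0,s_1$, depending only on $\delta_3,\delta_4,\alpha_0$, such that for every $\varepsilon>0$ there is an $m_0$ for which the following holds. Let $m\ge m_0$, $m\le n$, $4k\le n$, $\alpha=k/n\ge\alpha_0$; let $\Phi$ be an $m\times n$ matrix with the RIP of orders $k,3k,4k$ with constants $\delta_k,\delta_3,\delta_4$, and let $\beta$ be any noise constant of $\Phi$ for sparsity $k$; let $P,N>0$ with $P/N\ge s_0$ (high SNR). Put $$R=\frac km C+\frac nm H_b(\alpha)+\frac{k}{2m}\log_2\frac1{\beta(1+\delta_k)} .$$ Then there is a sparse channel code with $\lceil 2^{mR}\rceil$ messages such that receivers of the above form exist for it, and each of them has decoding complexity exactly $CX_{ml}(k)+CX_{cs}^{noisy}(m,n)$ for every received vector, and $P_e\le\varepsilon$. If moreover $P/N\ge s_1m$, the outer code $\mathcal C$ can be taken to be the set of all $k$-element patterns. In particular, over a channel of fixed SNR at least $s_0$, the rate $R$ is achievable ($P_e\to0$ as $m\to\infty$) with decoding complexity $CX_{ml}(k)+CX_{cs}^{noisy}(m,n)$. -/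

import Mathlib

open MeasureTheory ProbabilityTheory

namespace SparseChannel

noncomputable section

/-! ### Compressive sensing -/

/-- The sparsity pattern of a vector: the set of its nonzero coordinates. -/
def pattern {n : ℕ} (x : EuclideanSpace ℝ (Fin n)) : Finset (Fin n) :=
  {j | x j ≠ 0}

/-- The `L¹` norm of a vector. -/
def l1Norm {n : ℕ} (x : EuclideanSpace ℝ (Fin n)) : ℝ := ∑ j, |x j|

/-- The product `Φ x` of an `m × n` matrix with a vector, as a Euclidean vector. -/
def apply {m n : ℕ} (Φ : Matrix (Fin m) (Fin n) ℝ) (x : EuclideanSpace ℝ (Fin n)) :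
    EuclideanSpace ℝ (Fin m) := Matrix.toEuclideanLin Φ x

/-- `Φ` satisfies the restricted isometry property of order `s` with constant `δ`: up to the
factors `1 ± δ` it preserves the squared Euclidean norm of each vector with at most `s` nonzero
coordinates. -/
def RIP {m n : ℕ} (Φ : Matrix (Fin m) (Fin n) ℝ) (s : ℕ) (δ : ℝ) : Prop :=
  0 < δ ∧ δ < 1 ∧ ∀ v : EuclideanSpace ℝ (Fin n), (pattern v).card ≤ s →
    (1 - δ) * ‖v‖ ^ 2 ≤ ‖apply Φ v‖ ^ 2 ∧ ‖apply Φ v‖ ^ 2 ≤ (1 + δ) * ‖v‖ ^ 2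

/-- `x` solves the noisy compressive sensing program:
minimize `‖x‖₁` subject to `‖y - Φ x‖₂ ≤ ε`. -/
def IsNoisyCSSolution {m n : ℕ} (Φ : Matrix (Fin m) (Fin n) ℝ) (y : EuclideanSpace ℝ (Fin m))
    (ε : ℝ) (x : EuclideanSpace ℝ (Fin n)) : Prop :=
  ‖y - apply Φ x‖ ≤ ε ∧
    ∀ x' : EuclideanSpace ℝ (Fin n), ‖y - apply Φ x'‖ ≤ ε → l1Norm x ≤ l1Norm x'

/-- `β` is a noise amplification constant of the noisy compressive sensing program: whenever
`y = Φ x + z` with `x` `k`-sparse and `‖z‖₂ = ε`, each solution `x'` of the program satisfies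
`‖x - x'‖₂ ≤ β ε`. -/
def IsNoiseConstant {m n : ℕ} (Φ : Matrix (Fin m) (Fin n) ℝ) (k : ℕ) (β : ℝ) : Prop :=
  ∀ (x : EuclideanSpace ℝ (Fin n)) (z : EuclideanSpace ℝ (Fin m)) (ε : ℝ),
    (pattern x).card ≤ k → ‖z‖ = ε →
    ∀ x' : EuclideanSpace ℝ (Fin n), IsNoisyCSSolution Φ (apply Φ x + z) ε x' →
      ‖x - x'‖ ≤ β * ε

/-! ### Rates, in bits per channel use -/

/-- The capacity of the Gaussian channel with power constraint `P` and noise power `N`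
(asymptotically `½ log (P / N)` at high signal-to-noise ratio). -/
def capacity (P N : ℝ) : ℝ := 1 / 2 * Real.logb 2 (1 + P / N)

/-- The binary entropy function, in bits. -/
def binaryEntropy (p : ℝ) : ℝ := Real.binEntropy p / Real.log 2

/-- The rate `(k/m) C + (n/m) H_b(k/n) + (k/2m) log (1 / (β (1 + δ)))`. -/
def sparseRate (m n k : ℕ) (P N δ β : ℝ) : ℝ :=
  (k : ℝ) / m * capacity P N + (n : ℝ) / m * binaryEntropy ((k : ℝ) / n)
    + (k : ℝ) / (2 * m) * Real.logb 2 (1 / (β * (1 + δ)))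

/-- The number `2 ^ (m R)` of messages of a code of length `m` and rate `R`, rounded up. -/
def numMessages (m : ℕ) (R : ℝ) : ℕ := ⌈(2 : ℝ) ^ ((m : ℝ) * R)⌉₊

/-! ### Sparse channel codes -/

/-- A sparse channel code with `M` messages, length `m`, encoding matrix `Φ` and power constraint
`P`. Message `i` is mapped to a vector `x i` with exactly `k` nonzero coordinates, and the codeword
`Φ (x i)` is sent. The outer code is a collection of `k`-element sparsity patterns; it and the
threshold `τ` are known to the receiver. -/
structure Code (m n k M : ℕ) (Φ : Matrix (Fin m) (Fin n) ℝ) (P : ℝ) where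
  outer : Finset (Finset (Fin n))
  card_outer : ∀ S ∈ outer, S.card = k
  x : Fin M → EuclideanSpace ℝ (Fin n)
  pattern_mem : ∀ i, pattern (x i) ∈ outer
  power : ∀ i, 1 / (m : ℝ) * ∑ j, (apply Φ (x i) j) ^ 2 ≤ P
  τ : ℝ
  τ_pos : 0 < τ

namespace Code

variable {m n k M : ℕ} {Φ : Matrix (Fin m) (Fin n) ℝ} {P : ℝ}

/-- The codeword that is sent for message `i`. -/
def codeword (c : Code m n k M Φ P) (i : Fin M) : EuclideanSpace ℝ (Fin m) := apply Φ (c.x i)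

end Code

/-- The span of the columns of `Φ` with index in `S`: the space of all `Φ x` with `x`
supported in `S`. -/
def columnSpan {m n : ℕ} (Φ : Matrix (Fin m) (Fin n) ℝ) (S : Finset (Fin n)) :
    Submodule ℝ (EuclideanSpace ℝ (Fin m)) :=
  Submodule.span ℝ ((fun j => WithLp.toLp 2 (Φ.col j)) '' (S : Set (Fin n)))

/-- The set of coordinates of `x` whose absolute value is at least `τ`. -/
def thresholdPattern {n : ℕ} (τ : ℝ) (x : EuclideanSpace ℝ (Fin n)) : Finset (Fin n) :=
  {j | τ ≤ |x j|}

/-- The likelihood of the observation `u` when `w` was sent, in a `d`-dimensional Euclidean space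
with additive Gaussian noise of power `N` in each coordinate. -/
def likelihood {E : Type*} [NormedAddCommGroup E] (d : ℕ) (N : ℝ) (u w : E) : ℝ :=
  (Real.sqrt (2 * Real.pi * N))⁻¹ ^ d * Real.exp (-‖u - w‖ ^ 2 / (2 * N))

/-- An implementation of the three modules of the receiver of a sparse channel code.
* `cs` solves the noisy compressive sensing program
  `min ‖x‖₁` subject to `(1/m) ‖y - Φ x‖² ≤ N`, whenever the program is feasible.
* `detect` sees only the solution of that program. It compares the coordinates with the
  threshold and returns the pattern in the outer code that differs from the result in the least
  number of coordinates.
* `ml` is a maximum likelihood decoder in the space spanned by the columns of `Φ` that belong to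
  the detected pattern `S`: it sees only `S` and a vector of that space, and returns a message of
  greatest likelihood among those with pattern `S`, if there are any. -/
structure Decoder {m n k M : ℕ} {Φ : Matrix (Fin m) (Fin n) ℝ} {P : ℝ}
    (c : Code m n k M Φ P) (N : ℝ) where
  cs : EuclideanSpace ℝ (Fin m) → EuclideanSpace ℝ (Fin n)
  cs_spec : ∀ y, (∃ x, ‖y - apply Φ x‖ ≤ Real.sqrt (m * N)) →
    IsNoisyCSSolution Φ y (Real.sqrt (m * N)) (cs y)
  detect : EuclideanSpace ℝ (Fin n) → Finset (Fin n)
  detect_mem : ∀ x, detect x ∈ c.outer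
  detect_spec : ∀ x, ∀ S ∈ c.outer,
    (symmDiff (thresholdPattern c.τ x) (detect x)).card
      ≤ (symmDiff (thresholdPattern c.τ x) S).card
  ml : (S : Finset (Fin n)) → columnSpan Φ S → Fin M
  ml_spec : ∀ (S : Finset (Fin n)) (u : columnSpan Φ S), (∃ i, pattern (c.x i) = S) →
    pattern (c.x (ml S u)) = S ∧ ∀ i, pattern (c.x i) = S →
      likelihood (Module.finrank ℝ (columnSpan Φ S)) N
          (u : EuclideanSpace ℝ (Fin m)) (c.codeword i)
        ≤ likelihood (Module.finrank ℝ (columnSpan Φ S)) N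
          (u : EuclideanSpace ℝ (Fin m)) (c.codeword (ml S u))

/-- A value together with the complexity that was charged for computing it. -/
structure Timed (A : Type) where
  val : A
  time : ℕ

/-- Run a charged computation and feed its value to another one; the charges add up. -/
def Timed.bind {A B : Type} (a : Timed A) (f : A → Timed B) : Timed B :=
  ⟨(f a.val).val, a.time + (f a.val).time⟩

namespace Decoder

variable {m n k M : ℕ} {Φ : Matrix (Fin m) (Fin n) ℝ} {P N : ℝ} {c : Code m n k M Φ P}

/-- The whole receiver with its charges. Here `CXml d` is the complexity of a maximum likelihood
decoder in dimension `d`, and `CXcs m n` is the complexity of the noisy compressive sensing program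
with an `m × n` matrix; each use of one of them is charged. -/
def run (D : Decoder c N) (CXml : ℕ → ℕ) (CXcs : ℕ → ℕ → ℕ) (y : EuclideanSpace ℝ (Fin m)) :
    Timed (Fin M) :=
  Timed.bind ⟨D.cs y, CXcs m n⟩ fun x =>
    let S := D.detect x
    ⟨D.ml S ((columnSpan Φ S).orthogonalProjectionOnto y),
      CXml (Module.finrank ℝ (columnSpan Φ S))⟩

/-- The decoding function, which maps the received vector to a message. -/
def decode (D : Decoder c N) (y : EuclideanSpace ℝ (Fin m)) : Fin M :=
  (D.run (fun _ => 0) (fun _ _ => 0) y).val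

/-- The complexity of decoding the received vector `y`. -/
def complexity (D : Decoder c N) (CXml : ℕ → ℕ) (CXcs : ℕ → ℕ → ℕ)
    (y : EuclideanSpace ℝ (Fin m)) : ℕ :=
  (D.run CXml CXcs y).time

/-- The average probability of error over equally likely messages, when the channel adds a vector
with independent centered Gaussian coordinates of variance `N`. -/
def errorProb (D : Decoder c N) : ℝ :=
  1 / (M : ℝ) * ∑ i : Fin M,
    (Measure.pi fun _ : Fin m => gaussianReal 0 N.toNNReal).real
      {z | D.decode (c.codeword i + WithLp.toLp 2 z) ≠ i}

end Decoder

end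

end SparseChannel

/-! Part (a) is the Candès–Romberg–Tao argument. The error `h = x' - x` has at least half of its
`ℓ¹` norm on the pattern of `x`. Joining to that pattern the `3k` largest remaining entries gives a
head with at most `4k` entries, bounded below under `Φ` by the RIP of order `4k`. The tail splits
into blocks of size `3k`, whose images are controlled by the RIP of order `3k`. The condition `δ₃ +
3δ₄ < 2` says exactly that the head wins.

For (b), the noise norm may well exceed `√(mN)`, so the sent vector `x` need not be feasible. The
noise is therefore split along the span `V` of the active columns. Its component in `V` equals `Φ h`
with `h` supported on the same pattern, so `x + h` is still `k`-sparse, and its residual is the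
component in `Vᗮ`. That component has mean energy `(m - k)N`, below `mN` by a margin that
Chebyshev's inequality can use, because `k` is proportional to `m` or larger. Recovery then applies
to `x + h`, and `h` itself is short (`Decoder.decode_eq`).

If all active coordinates are at least `2τ`, each thresholding mistake costs error `τ`, so few
coordinates are wrong. An outer code of well separated patterns corrects them, and maximum
likelihood decoding succeeds when codewords with the same pattern are farther apart than twice the
typical noise in `V`.

Such codes are large enough by two volume arguments. A Gilbert–Varshamov bound keeps all patterns up
to a factor `(10/9)^k`, and a greedy packing in an ellipsoid supplies the codewords of each pattern
(`exists_packing`). The losses are paid for by `4k ≤ m` and by the fact that every noise constant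
satisfies `2 ≤ β(1 + δ)`, so that the last term of the rate gives up at least half a bit per active
coordinate (`numMessages_le`). The constant `β` enters only there; the receiver is analysed with
`recoveryConst`. -/

namespace SparseChannel

/-! ### Restrictions of vectors and the block decomposition -/

section CompressiveSensing

variable {m n : ℕ}

theorem apply_add (Φ : Matrix (Fin m) (Fin n) ℝ) (x y : EuclideanSpace ℝ (Fin n)) :
    apply Φ (x + y) = apply Φ x + apply Φ y := map_add (Matrix.toEuclideanLin Φ) x y

theorem apply_sub (Φ : Matrix (Fin m) (Fin n) ℝ) (x y : EuclideanSpace ℝ (Fin n)) :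
    apply Φ (x - y) = apply Φ x - apply Φ y := map_sub (Matrix.toEuclideanLin Φ) x y

theorem apply_smul (Φ : Matrix (Fin m) (Fin n) ℝ) (a : ℝ) (x : EuclideanSpace ℝ (Fin n)) :
    apply Φ (a • x) = a • apply Φ x := map_smul (Matrix.toEuclideanLin Φ) a x

theorem apply_zero (Φ : Matrix (Fin m) (Fin n) ℝ) : apply Φ 0 = 0 :=
  map_zero (Matrix.toEuclideanLin Φ)

theorem continuous_apply (Φ : Matrix (Fin m) (Fin n) ℝ) : Continuous (apply Φ) :=
  (Matrix.toEuclideanLin Φ).continuous_of_finiteDimensional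

theorem mem_pattern {x : EuclideanSpace ℝ (Fin n)} {j : Fin n} : j ∈ pattern x ↔ x j ≠ 0 := by
  simp [pattern]

theorem pattern_subset_iff {x : EuclideanSpace ℝ (Fin n)} {S : Finset (Fin n)} :
    pattern x ⊆ S ↔ ∀ j ∉ S, x j = 0 := by
  constructor
  · intro h j hj
    by_contra hne
    exact hj (h (mem_pattern.2 hne))
  · intro h j hj
    by_contra hne
    exact mem_pattern.1 hj (h j hne)

/-- The vector that agrees with `x` on `U` and vanishes outside of `U`. -/
noncomputable def restrictTo (U : Finset (Fin n)) (x : EuclideanSpace ℝ (Fin n)) :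
    EuclideanSpace ℝ (Fin n) := WithLp.toLp 2 fun j => if j ∈ U then x j else 0

@[simp] theorem restrictTo_apply (U : Finset (Fin n)) (x : EuclideanSpace ℝ (Fin n)) (j : Fin n) :
    restrictTo U x j = if j ∈ U then x j else 0 := rfl

theorem pattern_restrictTo_subset (U : Finset (Fin n)) (x : EuclideanSpace ℝ (Fin n)) :
    pattern (restrictTo U x) ⊆ U :=
  pattern_subset_iff.2 fun j hj => by simp [hj]

theorem norm_restrictTo_sq (U : Finset (Fin n)) (x : EuclideanSpace ℝ (Fin n)) :
    ‖restrictTo U x‖ ^ 2 = ∑ j ∈ U, x j ^ 2 := by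
  rw [EuclideanSpace.norm_sq_eq]
  simp [Finset.sum_ite_mem, ite_pow]

theorem restrictTo_add_of_disjoint {U V W : Finset (Fin n)} (x : EuclideanSpace ℝ (Fin n))
    (hd : Disjoint U V) (hW : ∀ j, j ∈ W ↔ j ∈ U ∨ j ∈ V) :
    restrictTo W x = restrictTo U x + restrictTo V x := by
  ext j
  have hj : j ∈ U → j ∉ V := fun h => Finset.disjoint_left.1 hd h
  by_cases h1 : j ∈ U <;> by_cases h2 : j ∈ V <;> simp_all

theorem norm_restrictTo_mono {U V : Finset (Fin n)} (h : U ⊆ V) (x : EuclideanSpace ℝ (Fin n)) :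
    ‖restrictTo U x‖ ≤ ‖restrictTo V x‖ := by
  refine le_of_sq_le_sq ?_ (norm_nonneg _)
  rw [norm_restrictTo_sq, norm_restrictTo_sq]
  exact Finset.sum_le_sum_of_subset_of_nonneg h fun _ _ _ => sq_nonneg _

theorem norm_restrictTo_le {U : Finset (Fin n)} {x : EuclideanSpace ℝ (Fin n)} {b : ℝ} {M : ℕ}
    (hU : U.card ≤ M) (hb0 : 0 ≤ b) (hb : ∀ j ∈ U, |x j| ≤ b) :
    ‖restrictTo U x‖ ≤ √M * b := by
  refine le_of_sq_le_sq ?_ (by positivity)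
  rw [norm_restrictTo_sq, mul_pow, Real.sq_sqrt (by positivity)]
  calc ∑ j ∈ U, x j ^ 2 ≤ ∑ j ∈ U, b ^ 2 :=
        Finset.sum_le_sum fun j hj => sq_le_sq.2 ((hb j hj).trans (le_abs_self b))
    _ = U.card * b ^ 2 := by simp
    _ ≤ M * b ^ 2 := by gcongr

theorem sum_abs_le_norm_restrictTo {U : Finset (Fin n)} (x : EuclideanSpace ℝ (Fin n)) {M : ℕ}
    (hU : U.card ≤ M) : ∑ j ∈ U, |x j| ≤ √M * ‖restrictTo U x‖ := by
  refine le_of_sq_le_sq ?_ (by positivity)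
  rw [mul_pow, norm_restrictTo_sq, Real.sq_sqrt (by positivity)]
  calc (∑ j ∈ U, |x j|) ^ 2 ≤ U.card * ∑ j ∈ U, |x j| ^ 2 := sq_sum_le_card_mul_sum_sq
    _ ≤ M * ∑ j ∈ U, |x j| ^ 2 := by gcongr
    _ = M * ∑ j ∈ U, x j ^ 2 := by simp

theorem sqrt_mul_div_natCast {M : ℕ} (hM : 0 < M) (a : ℝ) : √M * (a / M) = a / √M := by
  have hM' : (0 : ℝ) < √M := Real.sqrt_pos.2 (Nat.cast_pos.2 hM)
  have h : (M : ℝ) = √M * √M := (Real.mul_self_sqrt (Nat.cast_nonneg M)).symm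
  rw [h]
  simp only [Real.sqrt_mul_self hM'.le]
  field_simp

theorem exists_top_subset (g : Fin n → ℝ) (U : Finset (Fin n)) (M : ℕ) (hM : M ≤ U.card) :
    ∃ T ⊆ U, T.card = M ∧ ∀ i ∈ T, ∀ j ∈ U \ T, g j ≤ g i := by
  induction M with
  | zero => exact ⟨∅, by simp, by simp, by simp⟩
  | succ M ih =>
    obtain ⟨T, hT, hc, hg⟩ := ih (by omega)
    have hne : (U \ T).Nonempty := by
      rw [← Finset.card_pos, Finset.card_sdiff_of_subset hT]; omega
    obtain ⟨a, ha, hmax⟩ := Finset.exists_max_image (U \ T) g hne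
    have ha' := Finset.mem_sdiff.1 ha
    refine ⟨insert a T, Finset.insert_subset ha'.1 hT, by simp [ha'.2, hc], ?_⟩
    intro i hi j hj
    have hj' : j ∈ U \ T := by simp at hj ⊢; tauto
    rcases Finset.mem_insert.1 hi with rfl | hi
    · exact hmax j hj'
    · exact hg i hi j hj'

/-- The tail estimate behind the recovery bounds: cut `U` into blocks of size `M` with decreasing
entries. -/
theorem subadditive_restrictTo_le {f : EuclideanSpace ℝ (Fin n) → ℝ} {c : ℝ} {M : ℕ} (hM : 0 < M)
    (hc : 0 ≤ c) (hf : ∀ x y, f (x + y) ≤ f x + f y) (x : EuclideanSpace ℝ (Fin n))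
    (hfM : ∀ T : Finset (Fin n), T.card ≤ M → f (restrictTo T x) ≤ c * ‖restrictTo T x‖) :
    ∀ (s : ℕ) (U : Finset (Fin n)) (b : ℝ), U.card = s → 0 ≤ b → (∀ j ∈ U, |x j| ≤ b) →
      f (restrictTo U x) ≤ c * (√M * b + (∑ j ∈ U, |x j|) / √M) := by
  have hM' : (0 : ℝ) < √M := Real.sqrt_pos.2 (by exact_mod_cast hM)
  intro s
  induction s using Nat.strong_induction_on with
  | _ s ih =>
    intro U b hs hb0 hb
    rcases le_or_gt U.card M with hU | hU
    · refine (hfM U hU).trans (mul_le_mul_of_nonneg_left ?_ hc)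
      have := norm_restrictTo_le hU hb0 hb
      have h2 : 0 ≤ (∑ j ∈ U, |x j|) / √M := by positivity
      linarith
    · obtain ⟨T, hTU, hTc, hT⟩ := exists_top_subset (fun j => |x j|) U M hU.le
      have hsum : ∑ j ∈ U, |x j| = ∑ j ∈ T, |x j| + ∑ j ∈ U \ T, |x j| := by
        rw [add_comm, Finset.sum_sdiff hTU]
      -- Entries left over are at most the average over the removed block, so the next block has
      -- norm at most the `ℓ¹` norm of this one divided by `√M`.
      have hb' : ∀ j ∈ U \ T, |x j| ≤ (∑ i ∈ T, |x i|) / M := by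
        intro j hj
        rw [le_div_iff₀ (Nat.cast_pos.2 hM), mul_comm]
        calc (M : ℝ) * |x j| = ∑ _i ∈ T, |x j| := by simp [hTc]
          _ ≤ _ := Finset.sum_le_sum fun i hi => hT i hi j hj
      have h1 := ih (U \ T).card (by rw [Finset.card_sdiff_of_subset hTU]; omega) (U \ T)
        ((∑ i ∈ T, |x i|) / M) rfl (by positivity) hb'
      have h2 := hfM T hTc.le
      have h3 := norm_restrictTo_le hTc.le hb0 fun j hj => hb j (hTU hj)
      have h4 := hf (restrictTo T x) (restrictTo (U \ T) x)
      rw [← restrictTo_add_of_disjoint (W := U) x Finset.disjoint_sdiff (by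
        intro j; simp only [Finset.mem_sdiff]; have := @hTU j; tauto)] at h4
      have h5 : √M * ((∑ i ∈ T, |x i|) / M) = (∑ i ∈ T, |x i|) / √M :=
        sqrt_mul_div_natCast hM _
      rw [h5] at h1
      calc f (restrictTo U x) ≤ c * (√M * b) +
            c * ((∑ i ∈ T, |x i|) / √M + (∑ j ∈ U \ T, |x j|) / √M) := by
            refine h4.trans (add_le_add (h2.trans (mul_le_mul_of_nonneg_left h3 hc)) h1)
        _ = _ := by rw [hsum]; ring

/-- With the `M` largest entries removed, the term `√M * b` of the tail estimate is itself absorbed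
into the `ℓ¹` norm. The set `T` is chosen before `f`, so that the same tail is estimated in norm and
under `Φ`. -/
theorem exists_head_tail (x : EuclideanSpace ℝ (Fin n)) (U : Finset (Fin n)) {M : ℕ} (hM : 0 < M) :
    ∃ T ⊆ U, T.card ≤ M ∧ ∀ (f : EuclideanSpace ℝ (Fin n) → ℝ) (c : ℝ), 0 ≤ c →
      (∀ x y, f (x + y) ≤ f x + f y) →
      (∀ T : Finset (Fin n), T.card ≤ M → f (restrictTo T x) ≤ c * ‖restrictTo T x‖) →
      f (restrictTo (U \ T) x) ≤ c * ((∑ j ∈ U, |x j|) / √M) := by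
  have hM' : (0 : ℝ) < √M := Real.sqrt_pos.2 (by exact_mod_cast hM)
  rcases le_or_gt U.card M with hU | hU
  · refine ⟨U, subset_rfl, hU, fun f c hc _ hfM => ?_⟩
    have h := hfM (U \ U) (by simp)
    have h0 : ‖restrictTo (U \ U) x‖ = 0 := by
      rw [← sq_eq_zero_iff, norm_restrictTo_sq]; simp
    rw [h0, mul_zero] at h
    exact h.trans (by positivity)
  · obtain ⟨T, hTU, hTc, hT⟩ := exists_top_subset (fun j => |x j|) U M hU.le
    refine ⟨T, hTU, hTc.le, fun f c hc hf hfM => ?_⟩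
    have hb' : ∀ j ∈ U \ T, |x j| ≤ (∑ i ∈ T, |x i|) / M := by
      intro j hj
      rw [le_div_iff₀ (Nat.cast_pos.2 hM), mul_comm]
      calc (M : ℝ) * |x j| = ∑ _i ∈ T, |x j| := by simp [hTc]
        _ ≤ _ := Finset.sum_le_sum fun i hi => hT i hi j hj
    have h1 := subadditive_restrictTo_le hM hc hf x hfM _ (U \ T)
      ((∑ i ∈ T, |x i|) / M) rfl (by positivity) hb'
    have h5 : √M * ((∑ i ∈ T, |x i|) / M) = (∑ i ∈ T, |x i|) / √M :=
      sqrt_mul_div_natCast hM _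
    rw [h5, ← add_div, add_comm, Finset.sum_sdiff hTU] at h1
    exact h1

end CompressiveSensing

/-! ### Stable recovery and consequences of the RIP -/

section CompressiveSensing

variable {m n : ℕ}

theorem RIP.norm_apply_le {Φ : Matrix (Fin m) (Fin n) ℝ} {s : ℕ} {δ : ℝ} (h : RIP Φ s δ)
    {v : EuclideanSpace ℝ (Fin n)} (hv : (pattern v).card ≤ s) :
    ‖apply Φ v‖ ≤ √(1 + δ) * ‖v‖ := by
  have h0 := h.1
  refine le_of_sq_le_sq ?_ (by positivity)
  rw [mul_pow, Real.sq_sqrt (by linarith)]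
  exact (h.2.2 v hv).2

theorem RIP.le_norm_apply {Φ : Matrix (Fin m) (Fin n) ℝ} {s : ℕ} {δ : ℝ} (h : RIP Φ s δ)
    {v : EuclideanSpace ℝ (Fin n)} (hv : (pattern v).card ≤ s) :
    √(1 - δ) * ‖v‖ ≤ ‖apply Φ v‖ := by
  have h1 := h.2.1
  refine le_of_sq_le_sq ?_ (by positivity)
  rw [mul_pow, Real.sq_sqrt (by linarith)]
  exact (h.2.2 v hv).1

/-- The recovery constant of the program for matrices with the RIP of orders `3k` and `4k`. -/
noncomputable def recoveryConst (δ₃ δ₄ : ℝ) : ℝ := 4 / (√(1 - δ₄) - √((1 + δ₃) / 3))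

theorem recoveryConst_denom_pos {δ₃ δ₄ : ℝ} (hδ₃ : 0 < δ₃) (hδ : δ₃ + 3 * δ₄ < 2) :
    0 < √(1 - δ₄) - √((1 + δ₃) / 3) := by
  have := Real.sqrt_lt_sqrt (x := (1 + δ₃) / 3) (y := 1 - δ₄) (by linarith) (by linarith)
  linarith

theorem recoveryConst_pos {δ₃ δ₄ : ℝ} (hδ₃ : 0 < δ₃) (hδ : δ₃ + 3 * δ₄ < 2) :
    0 < recoveryConst δ₃ δ₄ := div_pos (by norm_num) (recoveryConst_denom_pos hδ₃ hδ)

/-- If `x'` has no greater `ℓ¹` norm than `x`, then at least half of the `ℓ¹` norm of `x' - x` sits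
on the pattern of `x`. -/
theorem sum_abs_compl_le {x x' : EuclideanSpace ℝ (Fin n)} (h : l1Norm x' ≤ l1Norm x) :
    ∑ j ∈ (pattern x)ᶜ, |(x' - x) j| ≤ ∑ j ∈ pattern x, |(x' - x) j| := by
  have h1 : ∀ y : EuclideanSpace ℝ (Fin n),
      l1Norm y = ∑ j ∈ pattern x, |y j| + ∑ j ∈ (pattern x)ᶜ, |y j| :=
    fun y => (Finset.sum_add_sum_compl _ _).symm
  have hz : ∀ j ∈ (pattern x)ᶜ, x j = 0 := fun j hj =>
    pattern_subset_iff.1 subset_rfl j (Finset.mem_compl.1 hj)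
  have h2 : ∑ j ∈ (pattern x)ᶜ, |x j| = 0 :=
    Finset.sum_eq_zero fun j hj => by rw [hz j hj, abs_zero]
  have h3 : ∑ j ∈ (pattern x)ᶜ, |(x' - x) j| = ∑ j ∈ (pattern x)ᶜ, |x' j| :=
    Finset.sum_congr rfl fun j hj => by simp [hz j hj]
  have h4 : ∑ j ∈ pattern x, |x j| ≤
      ∑ j ∈ pattern x, |x' j| + ∑ j ∈ pattern x, |(x' - x) j| := by
    rw [← Finset.sum_add_distrib]
    refine Finset.sum_le_sum fun j _ => ?_
    have := abs_sub_abs_le_abs_sub (x j) (x' j)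
    rw [abs_sub_comm] at this
    simp only [PiLp.sub_apply]
    linarith
  have h5 := h1 x
  have h6 := h1 x'
  linarith

/-- The tail obeys `‖Φ R‖ ≤ √((1 + δ₃)/3) ‖H‖` and the head `√(1 - δ₄) ‖H‖ ≤ ‖Φ H‖`, while `‖Φ h‖ ≤
2ε` since both vectors are feasible. Only feasibility of `x` is assumed, not that the residual has
norm `ε`; the receiver needs this generality. -/
theorem norm_sub_le_of_isNoisyCSSolution {δ₃ δ₄ : ℝ} (hδ : δ₃ + 3 * δ₄ < 2) {k : ℕ}
    {Φ : Matrix (Fin m) (Fin n) ℝ} (h3 : RIP Φ (3 * k) δ₃) (h4 : RIP Φ (4 * k) δ₄)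
    {x x' : EuclideanSpace ℝ (Fin n)} {y : EuclideanSpace ℝ (Fin m)} {ε : ℝ}
    (hx : (pattern x).card ≤ k) (hy : ‖y - apply Φ x‖ ≤ ε) (hx' : IsNoisyCSSolution Φ y ε x') :
    ‖x - x'‖ ≤ recoveryConst δ₃ δ₄ * ε := by
  have hε : 0 ≤ ε := (norm_nonneg _).trans hy
  have hC := recoveryConst_denom_pos h3.1 hδ
  have hl1 : l1Norm x' ≤ l1Norm x := hx'.2 x hy
  -- For `k = 0` there are no blocks of positive size, but then both vectors vanish.
  rcases Nat.eq_zero_or_pos k with rfl | hk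
  · have hx0 : x = 0 := by
      ext j
      have : pattern x = ∅ := Finset.card_eq_zero.1 (Nat.le_zero.1 hx)
      exact pattern_subset_iff.1 this.subset j (by simp)
    have h0 : l1Norm x' = 0 := by
      refine le_antisymm (hl1.trans (by simp [hx0, l1Norm]))
        (Finset.sum_nonneg fun _ _ => abs_nonneg _)
    have hx'0 : x' = 0 := by
      ext j
      exact abs_eq_zero.1 ((Finset.sum_eq_zero_iff_of_nonneg fun _ _ => abs_nonneg _).1 h0 j
        (Finset.mem_univ j))
    rw [hx0, hx'0, sub_zero, norm_zero]
    exact mul_nonneg (recoveryConst_pos h3.1 hδ).le hε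
  set h := x' - x with hh
  set T₀ := pattern x with hT₀
  have hcone := sum_abs_compl_le hl1
  rw [← hh, ← hT₀] at hcone
  obtain ⟨T, hT, hTc, htail⟩ := exists_head_tail h T₀ᶜ (M := 3 * k) (by omega)
  set t := (∑ j ∈ T₀ᶜ, |h j|) / √((3 * k : ℕ) : ℝ) with ht
  have hn := htail (fun v => ‖v‖) 1 zero_le_one norm_add_le (fun _ _ => by simp)
  have hΦ := htail (fun v => ‖apply Φ v‖) √(1 + δ₃) (by positivity)
    (fun v w => by rw [apply_add]; exact norm_add_le _ _)
    (fun T hT => h3.norm_apply_le ((Finset.card_le_card (pattern_restrictTo_subset _ _)).trans hT))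
  simp only [one_mul] at hn
  set H := restrictTo (T₀ ∪ T) h with hH
  set R := restrictTo (T₀ᶜ \ T) h with hR
  have hdecomp : h = H + R := by
    have : restrictTo Finset.univ h = H + R := by
      refine restrictTo_add_of_disjoint h ?_ ?_
      · rw [Finset.disjoint_left]; intro j; simp; tauto
      · intro j; simp; tauto
    rw [← this]; ext j; simp
  have htH : √3 * t ≤ ‖H‖ := by
    have hk' : (0 : ℝ) < √k := Real.sqrt_pos.2 (Nat.cast_pos.2 hk)
    have h5 := sum_abs_le_norm_restrictTo h hx
    have h6 := norm_restrictTo_mono (Finset.subset_union_left (s₁ := T₀) (s₂ := T)) h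
    rw [ht, Nat.cast_mul, Nat.cast_ofNat, Real.sqrt_mul (by norm_num), mul_div_assoc']
    rw [mul_div_mul_left _ _ (by positivity), div_le_iff₀ hk', mul_comm]
    calc _ ≤ _ := hcone
      _ ≤ _ := h5
      _ ≤ _ := by gcongr
  have ht3 : t ≤ ‖H‖ / √3 := by rw [le_div_iff₀ (by positivity), mul_comm]; exact htH
  have hH4 : √(1 - δ₄) * ‖H‖ ≤ ‖apply Φ H‖ := by
    refine h4.le_norm_apply ((Finset.card_le_card (pattern_restrictTo_subset _ _)).trans ?_)
    have := Finset.card_union_le T₀ T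
    omega
  have hΦh : ‖apply Φ h‖ ≤ 2 * ε := by
    have : apply Φ h = (y - apply Φ x) - (y - apply Φ x') := by rw [hh, apply_sub]; abel
    rw [this]
    have := norm_sub_le (y - apply Φ x) (y - apply Φ x')
    linarith [hx'.1]
  have hΦH : ‖apply Φ H‖ ≤ ‖apply Φ h‖ + ‖apply Φ R‖ := by
    have : apply Φ H = apply Φ h - apply Φ R := by rw [hdecomp, apply_add]; abel
    rw [this]; exact norm_sub_le _ _
  have hRb : ‖apply Φ R‖ ≤ √((1 + δ₃) / 3) * ‖H‖ := by
    refine hΦ.trans ?_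
    rw [Real.sqrt_div (by linarith [h3.1])]
    calc √(1 + δ₃) * t ≤ √(1 + δ₃) * (‖H‖ / √3) := by gcongr
      _ = _ := by ring
  have hmain : (√(1 - δ₄) - √((1 + δ₃) / 3)) * ‖H‖ ≤ 2 * ε := by nlinarith
  have hHb : ‖H‖ ≤ 2 * ε / (√(1 - δ₄) - √((1 + δ₃) / 3)) := by
    rw [le_div_iff₀ hC, mul_comm]; exact hmain
  have hRn : ‖R‖ ≤ ‖H‖ := by
    refine hn.trans (ht3.trans (div_le_self (norm_nonneg _) ?_))
    exact Real.one_le_sqrt.2 (by norm_num)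
  calc ‖x - x'‖ = ‖h‖ := by rw [hh, norm_sub_rev]
    _ ≤ ‖H‖ + ‖R‖ := by rw [hdecomp]; exact norm_add_le _ _
    -- One factor 2 comes from `‖R‖ ≤ ‖H‖`, the other from the two residuals; together they give the
    -- 4 in `recoveryConst`.
    _ ≤ 2 * (2 * ε / (√(1 - δ₄) - √((1 + δ₃) / 3))) := by linarith
    _ = _ := by rw [recoveryConst]; ring

theorem isNoiseConstant_recoveryConst {δ₃ δ₄ : ℝ} (hδ : δ₃ + 3 * δ₄ < 2) {k : ℕ}
    {Φ : Matrix (Fin m) (Fin n) ℝ} (h3 : RIP Φ (3 * k) δ₃) (h4 : RIP Φ (4 * k) δ₄) :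
    IsNoiseConstant Φ k (recoveryConst δ₃ δ₄) := fun x z ε hx hz x' hx' =>
  norm_sub_le_of_isNoisyCSSolution hδ h3 h4 hx (by simp [hz]) hx'

/-- A lower bound on noise constants. -/
theorem IsNoiseConstant.two_le {Φ : Matrix (Fin m) (Fin n) ℝ} {k : ℕ} {β δ : ℝ}
    (hβ : IsNoiseConstant Φ k β) (h : RIP Φ k δ) (hk : 0 < k) (hn : 0 < n) :
    2 ≤ β * (1 + δ) := by
  have hδ := h.1
  set e : EuclideanSpace ℝ (Fin n) := EuclideanSpace.single ⟨0, hn⟩ 1 with he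
  have hcard : ∀ a : ℝ, (pattern (a • e)).card ≤ k := fun a => by
    refine (Finset.card_le_card (t := {⟨0, hn⟩}) (pattern_subset_iff.2 fun j hj => ?_)).trans ?_
    · have : j ≠ ⟨0, hn⟩ := by simpa using hj
      simp [he, this]
    · simpa using Nat.succ_le_of_lt hk
  have hne : ‖e‖ = 1 := by simp [he]
  have h1 : ‖apply Φ e‖ ≤ √(1 + δ) := by
    have := h.norm_apply_le (v := e) (by simpa using hcard 1)
    rwa [hne, mul_one] at this
  -- Test case: the noise `-Φ e` turns `Φ (2e)` into `Φ e`, for which `0` is feasible and hence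
  -- optimal. The program errs by 2 at noise level `‖Φ e‖`.
  have h2 := hβ ((2 : ℝ) • e) (-apply Φ e) ‖apply Φ e‖ (hcard 2) (norm_neg _) 0 ⟨by
      rw [apply_smul, apply_zero, sub_zero, two_smul, add_neg_cancel_right], fun x' _ => by
      simpa [l1Norm] using Finset.sum_nonneg fun i _ => abs_nonneg (x' i)⟩
  rw [sub_zero, norm_smul, hne] at h2
  norm_num at h2
  have hβ0 : 0 < β := by
    by_contra hcon
    nlinarith [norm_nonneg (apply Φ e)]
  have h3 : √(1 + δ) ≤ 1 + δ := by
    rw [Real.sqrt_le_left (by linarith)]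
    nlinarith
  calc (2 : ℝ) ≤ β * ‖apply Φ e‖ := h2
    _ ≤ β * (1 + δ) := by gcongr; exact h1.trans h3

/-- The RIP makes `Φ` injective on vectors supported in the first `s` coordinates. With `s = 4k`
this yields `4k ≤ m`, which the rate estimate depends on. -/
theorem RIP.le_rows {Φ : Matrix (Fin m) (Fin n) ℝ} {s : ℕ} {δ : ℝ} (h : RIP Φ s δ) (hs : s ≤ n) :
    s ≤ m := by
  classical
  let L : (Fin s → ℝ) →ₗ[ℝ] EuclideanSpace ℝ (Fin m) :=
    (Matrix.toEuclideanLin Φ) ∘ₗ (WithLp.linearEquiv 2 ℝ (Fin n → ℝ)).symm.toLinearMap ∘ₗ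
      (Function.ExtendByZero.linearMap ℝ (Fin.castLE hs))
  have hL : Function.Injective L := by
    rw [injective_iff_map_eq_zero]
    intro a ha
    set v : EuclideanSpace ℝ (Fin n) := WithLp.toLp 2 (Function.extend (Fin.castLE hs) a 0) with hv
    have hav : apply Φ v = 0 := ha
    have hp : (pattern v).card ≤ s := by
      refine (Finset.card_le_card (t := Finset.univ.image (Fin.castLE hs))
        (pattern_subset_iff.2 fun j hj => ?_)).trans (Finset.card_image_le.trans (by simp))
      simp only [hv]
      rw [Function.extend_apply' _ _ _ (by simpa using hj)]; rfl
    have h1 := h.le_norm_apply hp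
    rw [hav, norm_zero] at h1
    have h2 : 0 < √(1 - δ) := Real.sqrt_pos.2 (by linarith [h.2.1])
    have h3 : ‖v‖ = 0 := le_antisymm (by nlinarith) (norm_nonneg _)
    have h4 : v = 0 := norm_eq_zero.1 h3
    ext i
    have h5 : v (Fin.castLE hs i) = 0 := by rw [h4]; rfl
    rw [hv] at h5
    simpa [(Fin.castLE_injective hs).extend_apply] using h5
  simpa using LinearMap.finrank_le_finrank_of_injective hL

end CompressiveSensing

/-! ### Binomial coefficients and constant weight codes -/

section Counting

theorem choose_mul_pow_succ_ratio (n i : ℕ) (p q : ℝ) (hi : i < n) :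
    (n.choose (i + 1) : ℝ) * p ^ (i + 1) * q ^ (n - (i + 1)) * ((i + 1) * q) =
      (n.choose i : ℝ) * p ^ i * q ^ (n - i) * ((n - i) * p) := by
  have h : (n.choose (i + 1) : ℝ) * (i + 1) = n.choose i * (n - i) := by
    have := Nat.choose_succ_right_eq n i
    rw [← Nat.cast_sub hi.le]
    exact_mod_cast this
  have h2 : q ^ (n - i) = q ^ (n - (i + 1)) * q := by
    rw [← pow_succ]; congr 1; omega
  rw [h2, pow_succ]
  linear_combination p ^ i * p * q ^ (n - (i + 1)) * q * h

/-- The largest term of the binomial expansion of `(k + (n - k)) ^ n`. -/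
theorem choose_mul_pow_le {n k : ℕ} (hk : 0 < k) (hkn : k < n) (i : ℕ) (hi : i ≤ n) :
    (n.choose i : ℝ) * k ^ i * ((n : ℝ) - k) ^ (n - i) ≤
      n.choose k * k ^ k * ((n : ℝ) - k) ^ (n - k) := by
  set g : ℕ → ℝ := fun i => (n.choose i : ℝ) * (k : ℝ) ^ i * ((n : ℝ) - k) ^ (n - i) with hg
  have hk' : (0 : ℝ) < k := Nat.cast_pos.2 hk
  have hq : (0 : ℝ) < (n : ℝ) - k := sub_pos.2 (Nat.cast_lt.2 hkn)
  have hg0 : ∀ i, 0 ≤ g i := fun i => by positivity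
  have hr : ∀ i < n, g (i + 1) * ((i + 1) * ((n : ℝ) - k)) = g i * ((n - i) * k) :=
    fun i hi => choose_mul_pow_succ_ratio n i k (n - k) hi
  -- The ratio of consecutive terms crosses 1 at `k`: terms increase up to index `k` and decrease
  -- afterwards.
  have hup : ∀ i < k, g i ≤ g (i + 1) := fun i hi => by
    have hi' : (i : ℝ) + 1 ≤ k := by exact_mod_cast hi
    have h1 : ((i : ℝ) + 1) * ((n : ℝ) - k) ≤ (n - i) * k := by nlinarith
    have h2 := hr i (by omega)
    have h3 : (0 : ℝ) < (i + 1) * ((n : ℝ) - k) := by positivity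
    refine le_of_mul_le_mul_right ?_ h3
    rw [h2]
    exact mul_le_mul_of_nonneg_left h1 (hg0 i)
  have hdown : ∀ i, k ≤ i → i < n → g (i + 1) ≤ g i := fun i hi hin => by
    have hi' : (k : ℝ) ≤ i := by exact_mod_cast hi
    have h1 : ((n : ℝ) - i) * k ≤ (i + 1) * ((n : ℝ) - k) := by nlinarith
    have h2 := hr i hin
    have h3 : (0 : ℝ) < (i + 1) * ((n : ℝ) - k) := by positivity
    refine le_of_mul_le_mul_right ?_ h3
    rw [h2]
    exact mul_le_mul_of_nonneg_left h1 (hg0 i)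
  rcases le_total i k with hik | hik
  · exact Nat.decreasingInduction' (P := fun j => g j ≤ g k)
      (fun j hj _ ih => (hup j hj).trans ih) hik le_rfl
  · change g i ≤ g k
    clear_value g
    induction i, hik using Nat.le_induction with
    | base => exact le_rfl
    | succ j hj ih => exact (hdown j hj (by omega)).trans (ih (by omega))

theorem pow_le_succ_mul_choose {n k : ℕ} (hk : 0 < k) (hkn : k < n) :
    (n : ℝ) ^ n ≤ (n + 1) * (n.choose k * k ^ k * ((n : ℝ) - k) ^ (n - k)) := by
  have h := add_pow (k : ℝ) ((n : ℝ) - k) n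
  rw [add_sub_cancel] at h
  rw [h]
  calc _ ≤ ∑ i ∈ Finset.range (n + 1), (n.choose k * k ^ k * ((n : ℝ) - k) ^ (n - k)) := by
        refine Finset.sum_le_sum fun i hi => ?_
        refine le_trans (le_of_eq ?_)
          (choose_mul_pow_le hk hkn i (Nat.lt_succ_iff.1 (Finset.mem_range.1 hi)))
        ring
    _ = _ := by simp

/-- Entropy bound for binomial coefficients. -/
theorem two_rpow_entropy_le {n k : ℕ} (hk : 0 < k) (hkn : k < n) :
    (2 : ℝ) ^ ((n : ℝ) * binaryEntropy ((k : ℝ) / n)) ≤ (n + 1) * n.choose k := by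
  have hk' : (0 : ℝ) < k := Nat.cast_pos.2 hk
  have hn' : (0 : ℝ) < n := Nat.cast_pos.2 (hk.trans hkn)
  have hq : (0 : ℝ) < (n : ℝ) - k := sub_pos.2 (Nat.cast_lt.2 hkn)
  have hlog : Real.log 2 ≠ 0 := (Real.log_pos one_lt_two).ne'
  have h1 : (2 : ℝ) ^ ((n : ℝ) * binaryEntropy ((k : ℝ) / n)) =
      (n : ℝ) ^ n / (k ^ k * ((n : ℝ) - k) ^ (n - k)) := by
    rw [Real.rpow_def_of_pos two_pos, binaryEntropy]
    rw [← Real.exp_log (x := (n : ℝ) ^ n / (k ^ k * ((n : ℝ) - k) ^ (n - k))) (by positivity)]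
    congr 1
    rw [Real.log_div (by positivity) (by positivity), Real.log_mul (by positivity) (by positivity),
      Real.log_pow, Real.log_pow, Real.log_pow, Real.binEntropy, Nat.cast_sub hkn.le]
    have h2 : 1 - (k : ℝ) / n = (n - k) / n := by field_simp
    rw [h2, Real.log_inv, Real.log_inv, Real.log_div hk'.ne' hn'.ne', Real.log_div hq.ne' hn'.ne']
    field_simp
    ring
  rw [h1, div_le_iff₀ (by positivity)]
  calc _ ≤ _ := pow_le_succ_mul_choose hk hkn
    _ = _ := by ring

/-- Chernoff bound for the number of small subsets. -/
theorem card_small_subsets_le (n : ℕ) {t lam : ℝ} (hlam : 0 < lam) (hlam1 : lam ≤ 1) :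
    ((Finset.univ.filter fun S : Finset (Fin n) => (S.card : ℝ) ≤ t).card : ℝ) ≤
      lam ^ (-t) * (1 + lam) ^ n := by
  have h : (1 + lam) ^ n = ∑ S : Finset (Fin n), lam ^ S.card := by
    rw [add_comm]
    have := Finset.sum_pow_mul_eq_add_pow lam 1 (Finset.univ : Finset (Fin n))
    simp at this
    rw [← this]
  rw [h, Finset.mul_sum, ← nsmul_one, ← Finset.sum_const, Finset.sum_filter]
  refine Finset.sum_le_sum fun S _ => ?_
  split_ifs with hS
  -- Each small set contributes `lam ^ (card - t) ≥ 1`, because the exponent is not positive and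
  -- `lam ≤ 1`.
  · rw [← Real.rpow_natCast, ← Real.rpow_add hlam]
    exact Real.one_le_rpow_of_pos_of_le_one_of_nonpos hlam hlam1 (by linarith)
  · positivity

/-- Gilbert–Varshamov bound for constant weight codes. -/
theorem exists_separated_patterns (n k : ℕ) {t : ℝ} (ht : 0 ≤ t) :
    ∃ C : Finset (Finset (Fin n)), C ⊆ Finset.univ.powersetCard k ∧
      (∀ S ∈ C, ∀ T ∈ C, ((symmDiff S T).card : ℝ) ≤ t → S = T) ∧
      n.choose k ≤
        C.card * (Finset.univ.filter fun S : Finset (Fin n) => (S.card : ℝ) ≤ t).card := by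
  classical
  set B := Finset.univ.filter fun S : Finset (Fin n) => (S.card : ℝ) ≤ t with hB
  set A : Finset (Finset (Finset (Fin n))) :=
    (Finset.univ.powersetCard k).powerset.filter fun C =>
      ∀ S ∈ C, ∀ T ∈ C, ((symmDiff S T).card : ℝ) ≤ t → S = T with hA
  obtain ⟨C, hC, hmax⟩ := A.exists_max_image Finset.card ⟨∅, by simp [hA]⟩
  simp only [hA, Finset.mem_filter, Finset.mem_powerset] at hC hmax
  refine ⟨C, hC.1, hC.2, ?_⟩
  -- A code of maximal cardinality cannot be extended, so the balls of radius `t` around its words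
  -- cover all `k`-sets.
  have hcover : Finset.univ.powersetCard k ⊆
      C ∪ C.biUnion fun S => B.image fun T => symmDiff S T := by
    intro T hT
    by_contra hcon
    simp only [Finset.mem_union, Finset.mem_biUnion, Finset.mem_image, not_or, not_exists, not_and]
      at hcon
    have hfar : ∀ S ∈ C, ¬ ((symmDiff S T).card : ℝ) ≤ t := fun S hS hle =>
      hcon.2 S hS (symmDiff S T) (by simpa [hB] using hle) (by simp)
    have := hmax (insert T C) ⟨Finset.insert_subset hT hC.1, by
      intro S hS S' hS' hle
      rcases Finset.mem_insert.1 hS with h1 | hS <;> rcases Finset.mem_insert.1 hS' with h2 | hS'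
      · rw [h1, h2]
      · exact absurd (by rwa [symmDiff_comm, ← h1]) (hfar S' hS')
      · exact absurd (by rwa [← h2]) (hfar S hS)
      · exact hC.2 S hS S' hS' hle⟩
    rw [Finset.card_insert_of_notMem hcon.1] at this
    omega
  have hsub : C ⊆ C.biUnion fun S => B.image fun T => symmDiff S T := fun S hS =>
    Finset.mem_biUnion.2 ⟨S, hS, Finset.mem_image.2 ⟨∅, by simpa [hB] using ht, by simp⟩⟩
  rw [Finset.union_eq_right.2 hsub] at hcover
  calc n.choose k = (Finset.univ.powersetCard k : Finset (Finset (Fin n))).card := by simp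
    _ ≤ _ := Finset.card_le_card hcover
    _ ≤ C.card * B.card := Finset.card_biUnion_le_card_mul _ _ _ fun S _ => Finset.card_image_le

end Counting

/-! ### Energy of Gaussian noise in a subspace -/

section ChiSquare

/-- The variance of the square of a standard Gaussian variable. -/
noncomputable def chiSquareVar : ℝ := Var[fun x : ℝ => x ^ 2; gaussianReal 0 1]

theorem chiSquareVar_nonneg : 0 ≤ chiSquareVar := variance_nonneg _ _

theorem memLp_sq_gaussianReal : MemLp (fun x : ℝ => x ^ 2) 2 (gaussianReal 0 1) := by
  have h := (memLp_id_gaussianReal' (μ := 0) (v := 1) 4 (by simp))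
  have h2 := MemLp.mul (p := 4) (q := 4) (r := 2) h h (hpqr := ⟨by
    rw [show (4 : ENNReal) = 2 * 2 by norm_num, ENNReal.mul_inv (by simp) (by simp), ← mul_add,
      ENNReal.inv_two_add_inv_two, mul_one]⟩)
  refine h2.congr_norm ?_ ?_
  · fun_prop
  · exact Filter.Eventually.of_forall fun x => by simp [sq]

theorem integral_sq_gaussianReal : ∫ x, x ^ 2 ∂(gaussianReal 0 1) = 1 := by
  have h := variance_fun_id_gaussianReal (μ := 0) (v := 1)
  rw [variance_of_integral_eq_zero (by fun_prop) (by simp)] at h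
  simpa using h

theorem measure_sum_sq_ge_le {ι : Type*} [Fintype ι] (s : Finset ι) {c : ℝ} (hc : 0 < c) :
    (Measure.pi fun _ : ι => gaussianReal 0 1) {x | s.card + c ≤ ∑ i ∈ s, x i ^ 2} ≤
      ENNReal.ofReal (s.card * chiSquareVar / c ^ 2) := by
  classical
  set μ := Measure.pi fun _ : ι => gaussianReal 0 1 with hμ
  -- Zero outside `s`, so that the variance formula for sums over the whole product applies.
  set X : ι → ℝ → ℝ := fun i x => if i ∈ s then x ^ 2 else 0 with hX
  have hXm : ∀ i, MemLp (X i) 2 (gaussianReal 0 1) := fun i => by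
    by_cases hi : i ∈ s
    · simpa [hX, hi] using memLp_sq_gaussianReal
    · simp [hX, hi]
  have hvar := variance_sum_pi (μ := fun _ : ι => gaussianReal 0 1) hXm
  have hv : ∑ i, Var[X i; gaussianReal 0 1] = s.card * chiSquareVar := by
    rw [← nsmul_eq_mul, ← Finset.sum_const, ← Finset.sum_filter_add_sum_filter_not _ (· ∈ s)]
    rw [Finset.filter_mem_eq_inter, Finset.univ_inter, Finset.sum_eq_zero (s := Finset.filter _ _),
      add_zero]
    · exact Finset.sum_congr rfl fun i hi => by simp [hX, hi, chiSquareVar]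
    · intro i hi
      simp only [Finset.mem_filter] at hi
      have : X i = fun _ => 0 := by simp [hX, hi.2]
      rw [this]; exact variance_zero _
  have hcomp : ∀ i, MemLp (fun ω : ι → ℝ => X i (ω i)) 2 μ := fun i =>
    (hXm i).comp_measurePreserving (measurePreserving_eval _ i)
  have hmem : MemLp (∑ i, fun ω : ι → ℝ => X i (ω i)) 2 μ :=
    memLp_finsetSum' _ fun i _ => hcomp i
  have hsum : ∀ ω : ι → ℝ, (∑ i, fun ω : ι → ℝ => X i (ω i)) ω = ∑ i ∈ s, ω i ^ 2 := fun ω => by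
    simp [hX, Finset.sum_apply]
  have hmean : ∫ ω, (∑ i, fun ω : ι → ℝ => X i (ω i)) ω ∂μ = s.card := by
    simp only [Finset.sum_apply]
    rw [integral_finsetSum _ fun i _ => (hcomp i).integrable (by norm_num)]
    have : ∀ i, ∫ ω, X i (ω i) ∂μ = if i ∈ s then 1 else 0 := fun i => by
      rw [integral_comp_eval (μ := fun _ : ι => gaussianReal 0 1) (f := X i)
        (hXm i).aestronglyMeasurable]
      by_cases hi : i ∈ s
      · simp [hX, hi, integral_sq_gaussianReal]
      · simp [hX, hi]
    simp [this]
  have hcheb := meas_ge_le_variance_div_sq hmem hc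
  rw [hmean, hvar, hv] at hcheb
  refine (measure_mono fun x hx => ?_).trans hcheb
  simp only [Set.mem_ofPred_eq] at hx ⊢
  rw [hsum]
  exact (by linarith : c ≤ ∑ i ∈ s, x i ^ 2 - s.card).trans (le_abs_self _)

theorem exists_adapted_orthonormalBasis {m : ℕ} (V : Submodule ℝ (EuclideanSpace ℝ (Fin m))) :
    ∃ (b : OrthonormalBasis (Fin m) ℝ (EuclideanSpace ℝ (Fin m))) (s : Finset (Fin m)),
      s.card = Module.finrank ℝ V ∧
      ∀ z, ‖V.orthogonalProjectionOnto z‖ ^ 2 = ∑ i ∈ s, inner ℝ (b i) z ^ 2 := by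
  have hd : Module.finrank ℝ V ≤ m := by simpa using Submodule.finrank_le V
  set bV := stdOrthonormalBasis ℝ V
  -- The value `0` is only padding: orthonormality is required, and the extension agrees with `v`,
  -- only on `s`.
  set v : Fin m → EuclideanSpace ℝ (Fin m) := fun i =>
    if h : (i : ℕ) < Module.finrank ℝ V then (bV ⟨i, h⟩ : EuclideanSpace ℝ (Fin m)) else 0 with hv
  set s : Set (Fin m) := {i | (i : ℕ) < Module.finrank ℝ V} with hs
  have hon : Orthonormal ℝ (s.domRestrict v) := by
    have h1 : Orthonormal ℝ fun i => (bV i : EuclideanSpace ℝ (Fin m)) :=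
      bV.orthonormal.comp_linearIsometry V.subtypeₗᵢ
    have h2 := h1.comp (fun i : s => (⟨i, i.2⟩ : Fin (Module.finrank ℝ V))) (by
      intro i j hij
      simp only [Fin.mk.injEq] at hij
      exact Subtype.ext (Fin.ext hij))
    convert h2 using 1
    ext1 i
    have : ((i : Fin m) : ℕ) < Module.finrank ℝ V := i.2
    simp only [hv, Set.domRestrict_apply, dif_pos this, Function.comp_apply]
  obtain ⟨b, hb⟩ := hon.exists_orthonormalBasis_extension_of_card_eq (by simp)
  refine ⟨b, Finset.univ.map (Fin.castLEEmb hd), by simp, fun z => ?_⟩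
  rw [Finset.sum_map, ← bV.sum_sq_norm_inner_right]
  refine Finset.sum_congr rfl fun i _ => ?_
  have h3 : b (Fin.castLEEmb hd i) = bV i := by
    rw [hb _ (by simp [hs])]
    simp [hv]
  rw [h3, Real.norm_eq_abs, sq_abs,
    Submodule.inner_orthogonalProjectionOnto_eq_of_mem_left]

/-- Chebyshev bound for the energy of white Gaussian noise in a subspace. -/
theorem measure_norm_projection_sq_ge_le {m : ℕ} (V : Submodule ℝ (EuclideanSpace ℝ (Fin m)))
    {N c : ℝ} (hN : 0 < N) (hc : 0 < c) :
    (Measure.pi fun _ : Fin m => gaussianReal 0 N.toNNReal)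
      {z | N * (Module.finrank ℝ V + c) ≤ ‖V.orthogonalProjectionOnto (WithLp.toLp 2 z)‖ ^ 2} ≤
      ENNReal.ofReal (Module.finrank ℝ V * chiSquareVar / c ^ 2) := by
  obtain ⟨b, s, hs, hb⟩ := exists_adapted_orthonormalBasis V
  have hg : gaussianReal 0 N.toNNReal = (gaussianReal 0 1).map fun x => √N * x := by
    rw [gaussianReal_map_const_mul, mul_zero]
    congr 1
    ext
    simp [hN.le]
  have hpi : (Measure.pi fun _ : Fin m => gaussianReal 0 N.toNNReal) =
      (Measure.pi fun _ : Fin m => gaussianReal 0 1).map fun x i => √N * x i := by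
    have : SigmaFinite ((gaussianReal 0 1).map fun x => √N * x) := by rw [← hg]; infer_instance
    rw [Measure.pi_map_pi fun _ => by fun_prop, hg]
  have hrw : ∀ c' : ℝ, MeasurableSet {z : Fin m → ℝ |
      c' ≤ ‖V.orthogonalProjectionOnto (WithLp.toLp 2 z)‖ ^ 2} := fun c' =>
    measurableSet_le measurable_const (by fun_prop)
  have hmeas : Measurable fun z : EuclideanSpace ℝ (Fin m) =>
      ‖V.orthogonalProjectionOnto z‖ ^ 2 := by fun_prop
  have htoLp : Measurable (WithLp.toLp 2 : (Fin m → ℝ) → EuclideanSpace ℝ (Fin m)) := by fun_prop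
  rw [hpi, Measure.map_apply (by fun_prop) (hrw _)]
  have hset : (fun (x : Fin m → ℝ) i => √N * x i) ⁻¹'
      {z | N * (Module.finrank ℝ V + c) ≤ ‖V.orthogonalProjectionOnto (WithLp.toLp 2 z)‖ ^ 2} =
      WithLp.toLp 2 ⁻¹' {z : EuclideanSpace ℝ (Fin m) |
        Module.finrank ℝ V + c ≤ ‖V.orthogonalProjectionOnto z‖ ^ 2} := by
    ext x
    have : (WithLp.toLp 2 fun i => √N * x i : EuclideanSpace ℝ (Fin m)) = √N • WithLp.toLp 2 x := by
      ext i; simp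
    simp only [Set.mem_preimage, Set.mem_ofPred_eq]
    rw [this, map_smul, norm_smul, mul_pow, Real.norm_eq_abs, sq_abs, Real.sq_sqrt hN.le,
      mul_le_mul_iff_right₀ hN]
  have hB : MeasurableSet {z : EuclideanSpace ℝ (Fin m) |
      Module.finrank ℝ V + c ≤ ‖V.orthogonalProjectionOnto z‖ ^ 2} :=
    measurableSet_le measurable_const hmeas
  -- Rotation invariance: in the basis `b` adapted to `V` the coordinates are again independent
  -- standard Gaussians.
  rw [hset, ← Measure.map_apply htoLp hB, map_pi_eq_stdGaussian,
    stdGaussian_eq_map_pi_orthonormalBasis b, Measure.map_apply (by fun_prop) hB, ← hs]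
  refine le_trans (measure_mono fun x hx => ?_) (measure_sum_sq_ge_le s hc)
  simp only [Set.mem_preimage, Set.mem_ofPred_eq] at hx ⊢
  rw [hb] at hx
  refine hx.trans (le_of_eq (Finset.sum_congr rfl fun i _ => ?_))
  rw [b.orthonormal.inner_right_fintype]

end ChiSquare

/-! ### Packing ellipsoids away from the coordinate hyperplanes -/

section Packing

open scoped Pointwise

/-- Move `t` away from `0` by `a`. -/
noncomputable def pushAway (a t : ℝ) : ℝ := if 0 ≤ t then t + a else t - a

theorem le_abs_pushAway {a : ℝ} (t : ℝ) : a ≤ |pushAway a t| := by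
  unfold pushAway
  split_ifs with h
  · exact (by linarith : a ≤ t + a).trans (le_abs_self _)
  · exact (by linarith : a ≤ -(t - a)).trans (neg_le_abs _)

theorem measurable_pushAway (a : ℝ) : Measurable (pushAway a) :=
  Measurable.ite measurableSet_Ici (by fun_prop) (by fun_prop)

/-- The two half-lines are translated apart, opening a gap around `0`. Coordinates can thus be
forced to be large without any loss of volume. -/
theorem measurePreserving_pushAway {a : ℝ} (ha : 0 ≤ a) :
    MeasurePreserving (pushAway a) volume (volume.restrict (Set.Ici a ∪ Set.Iio (-a))) := by
  refine ⟨measurable_pushAway a, Measure.ext fun A hA => ?_⟩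
  rw [Measure.map_apply (measurable_pushAway a) hA, Measure.restrict_apply hA,
    ← measure_inter_add_sdiff _ (measurableSet_Ici (a := (0 : ℝ))),
    ← measure_inter_add_sdiff (A ∩ _) (measurableSet_Ici (a := a))]
  congr 1
  · rw [← measure_preimage_add_right volume a (A ∩ _ ∩ _)]
    congr 1
    ext t
    simp only [Set.mem_inter_iff, Set.mem_preimage, Set.mem_Ici, Set.mem_union, Set.mem_Iio]
    constructor
    · rintro ⟨h1, h2⟩
      rw [pushAway, if_pos h2] at h1
      exact ⟨⟨h1, Or.inl (by linarith)⟩, by linarith⟩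
    · rintro ⟨⟨h1, _⟩, h2⟩
      have h0 : 0 ≤ t := by linarith
      rw [pushAway, if_pos h0]
      exact ⟨h1, h0⟩
  · rw [← measure_preimage_add_right volume (-a) ((A ∩ _) \ _)]
    congr 1
    ext t
    simp only [Set.mem_inter_iff, Set.mem_preimage, Set.mem_Ici, Set.mem_union, Set.mem_Iio,
      Set.mem_sdiff]
    constructor
    · rintro ⟨h1, h2⟩
      rw [pushAway, if_neg h2] at h1
      exact ⟨⟨h1, Or.inr (by linarith)⟩, by linarith⟩
    · rintro ⟨⟨h1, h2⟩, h3⟩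
      have h0 : ¬ 0 ≤ t := by
        rcases h2 with h2 | h2 <;> linarith
      rw [pushAway, if_neg h0]
      exact ⟨h1, h0⟩

theorem volume_preimage_pushAway_le {ι : Type*} [Fintype ι] {a : ℝ} (ha : 0 ≤ a)
    {A : Set (ι → ℝ)} (hA : MeasurableSet A) :
    volume ((fun (x : ι → ℝ) i => pushAway a (x i)) ⁻¹' A) ≤ volume A := by
  have h := measurePreserving_pi (ι := ι) (fun _ => (volume : Measure ℝ))
    (fun _ => volume.restrict (Set.Ici a ∪ Set.Iio (-a))) fun _ => measurePreserving_pushAway ha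
  rw [← Measure.restrict_pi_pi] at h
  rw [volume_pi, h.measure_preimage hA.nullMeasurableSet]
  exact Measure.restrict_apply_le _ _

variable {ι F : Type*} [Fintype ι] [NormedAddCommGroup F] [NormedSpace ℝ F]

theorem volume_norm_linearMap_le (T : (ι → ℝ) →ₗ[ℝ] F) {ρ : ℝ} (hρ : 0 < ρ) :
    volume {x | ‖T x‖ ≤ ρ} = ENNReal.ofReal (ρ ^ Fintype.card ι) * volume {x | ‖T x‖ ≤ 1} := by
  have h : {x | ‖T x‖ ≤ ρ} = ρ • {x | ‖T x‖ ≤ 1} := by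
    ext x
    rw [Set.mem_smul_set_iff_inv_smul_mem₀ hρ.ne']
    simp only [Set.mem_ofPred_eq, map_smul, norm_smul, norm_inv, Real.norm_eq_abs, abs_of_pos hρ]
    rw [inv_mul_le_iff₀ hρ, mul_one]
  rw [h, Measure.addHaar_smul, Module.finrank_fintype_fun_eq_card, abs_of_pos (by positivity)]

theorem volume_unit_linearMap_pos (T : (ι → ℝ) →ₗ[ℝ] F) :
    0 < volume {x | ‖T x‖ ≤ 1} := by
  have hc : Continuous T := T.continuous_of_finiteDimensional
  have ho : IsOpen {x | ‖T x‖ < 1} := isOpen_lt hc.norm continuous_const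
  exact (ho.measure_pos volume ⟨0, by simp⟩).trans_le (measure_mono fun x (hx : ‖T x‖ < 1) => hx.le)

theorem volume_unit_linearMap_lt_top (T : (ι → ℝ) →ₗ[ℝ] F) (hT : Function.Injective T) :
    volume {x | ‖T x‖ ≤ 1} < ⊤ := by
  obtain ⟨K, _, hK⟩ := T.exists_antilipschitzWith (LinearMap.ker_eq_bot.2 hT)
  refine lt_of_le_of_lt (measure_mono (t := Metric.closedBall 0 (K * 1)) fun x hx => ?_)
    measure_closedBall_lt_top
  rw [Metric.mem_closedBall]
  refine (hK.le_mul_dist x 0).trans ?_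
  rw [map_zero, dist_zero_right]
  exact mul_le_mul_of_nonneg_left hx K.2

/-- A packing in an ellipsoid, away from the coordinate hyperplanes. -/
theorem exists_packing (T : (ι → ℝ) →ₗ[ℝ] F) (hT : Function.Injective T) {a b ρ r : ℝ}
    (ha : 0 ≤ a) (hρ : 0 < ρ) (hr : 0 < r)
    (hb : ∀ σ : ι → ℝ, (∀ i, |σ i| = a) → ‖T σ‖ ≤ b) (L : ℕ)
    (hL : (L : ℝ) < (ρ / r) ^ Fintype.card ι + 1) :
    ∃ X : Finset (ι → ℝ), X.card = L ∧ (∀ x ∈ X, (∀ i, a ≤ |x i|) ∧ ‖T x‖ ≤ ρ + b) ∧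
      ∀ x ∈ X, ∀ y ∈ X, ‖T (x - y)‖ ≤ r → x = y := by
  classical
  induction L with
  | zero => exact ⟨∅, by simp⟩
  | succ L ih =>
    push_cast at hL
    obtain ⟨X, hXc, hX, hsep⟩ := ih (by linarith)
    have hc : Continuous T := T.continuous_of_finiteDimensional
    set A : Set (ι → ℝ) := ⋃ x ∈ X, {y | ‖T (y - x)‖ ≤ r} with hA
    have hmeas : MeasurableSet A := by
      refine Finset.measurableSet_biUnion _ fun x _ => IsClosed.measurableSet ?_
      exact isClosed_le (by fun_prop) continuous_const
    have hvol : volume A ≤ L * (ENNReal.ofReal (r ^ Fintype.card ι) * volume {x | ‖T x‖ ≤ 1}) := by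
      refine (measure_biUnion_finset_le _ _).trans ?_
      rw [← hXc, ← nsmul_eq_mul, ← Finset.sum_const]
      refine Finset.sum_le_sum fun x _ => le_of_eq ?_
      rw [← volume_norm_linearMap_le T hr, ← measure_preimage_add_right volume x]
      simp only [Set.preimage_ofPred_eq, add_sub_cancel_right]
    -- Fewer than `(ρ/r)^d` ellipsoids of size `r` cannot fill one of size `ρ`. Pushing does not
    -- enlarge the volume of the preimage of `A`, so some pushed point of the large ellipsoid avoids
    -- all of them.
    have hlt : volume A < volume {x | ‖T x‖ ≤ ρ} := by
      refine hvol.trans_lt ?_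
      rw [volume_norm_linearMap_le T hρ, ← mul_assoc]
      refine ENNReal.mul_lt_mul_left (volume_unit_linearMap_pos T).ne'
        (volume_unit_linearMap_lt_top T hT).ne ?_
      rw [← ENNReal.ofReal_natCast, ← ENNReal.ofReal_mul (by positivity)]
      refine (ENNReal.ofReal_lt_ofReal_iff (by positivity)).2 ?_
      have h1 : (L : ℝ) < (ρ / r) ^ Fintype.card ι := by linarith
      rw [div_pow, lt_div_iff₀ (by positivity)] at h1
      exact h1
    have hnot : ¬ {x | ‖T x‖ ≤ ρ} ⊆ (fun (x : ι → ℝ) i => pushAway a (x i)) ⁻¹' A := fun hsub =>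
      absurd ((measure_mono hsub).trans (volume_preimage_pushAway_le ha hmeas)) (not_le.2 hlt)
    obtain ⟨y, hy, hyA⟩ := Set.not_subset.1 hnot
    set z : ι → ℝ := fun i => pushAway a (y i) with hz
    have hfar : ∀ x ∈ X, ¬ ‖T (z - x)‖ ≤ r := fun x hx hle => hyA (by
      simp only [Set.mem_preimage, hA, Set.mem_iUnion]
      exact ⟨x, hx, hle⟩)
    have hzX : z ∉ X := fun hmem => hfar z hmem (by simpa using hr.le)
    refine ⟨insert z X, by rw [Finset.card_insert_of_notMem hzX, hXc], ?_, ?_⟩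
    · intro x hx
      rcases Finset.mem_insert.1 hx with rfl | hx
      · refine ⟨fun i => le_abs_pushAway _, ?_⟩
        have h1 : z = y + (z - y) := by abel
        rw [h1, map_add]
        refine (norm_add_le _ _).trans (add_le_add hy (hb _ fun i => ?_))
        simp only [hz, Pi.sub_apply, pushAway]
        split_ifs <;> simp [abs_of_nonneg ha]
      · exact hX x hx
    · intro x hx x' hx' hle
      rcases Finset.mem_insert.1 hx with h1 | hx <;> rcases Finset.mem_insert.1 hx' with h2 | hx'
      · rw [h1, h2]
      · exact absurd (by rwa [← h1]) (hfar x' hx')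
      · refine absurd ?_ (hfar x hx)
        rwa [← h2, ← norm_neg, ← map_neg, neg_sub]
      · exact hsep x hx x' hx' hle

end Packing

/-! ### Existence and correctness of the receiver -/

section Receiver

variable {m n : ℕ}

theorem apply_eq_sum (Φ : Matrix (Fin m) (Fin n) ℝ) (x : EuclideanSpace ℝ (Fin n)) :
    apply Φ x = ∑ j, x j • (WithLp.toLp 2 (Φ.col j) : EuclideanSpace ℝ (Fin m)) := by
  ext i
  simp [apply, Matrix.mulVec, dotProduct, mul_comm]

theorem apply_mem_columnSpan (Φ : Matrix (Fin m) (Fin n) ℝ) {x : EuclideanSpace ℝ (Fin n)}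
    {S : Finset (Fin n)} (hx : pattern x ⊆ S) : apply Φ x ∈ columnSpan Φ S := by
  rw [apply_eq_sum]
  refine Submodule.sum_mem _ fun j _ => ?_
  by_cases hj : j ∈ S
  · exact Submodule.smul_mem _ _ (Submodule.subset_span ⟨j, hj, rfl⟩)
  · rw [pattern_subset_iff.1 hx j hj, zero_smul]
    exact Submodule.zero_mem _

theorem exists_apply_eq_of_mem_columnSpan {Φ : Matrix (Fin m) (Fin n) ℝ} {S : Finset (Fin n)}
    {u : EuclideanSpace ℝ (Fin m)} (hu : u ∈ columnSpan Φ S) :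
    ∃ h : EuclideanSpace ℝ (Fin n), pattern h ⊆ S ∧ apply Φ h = u := by
  unfold columnSpan at hu
  induction hu using Submodule.span_induction with
  | mem u hu =>
    obtain ⟨j, hj, rfl⟩ := hu
    refine ⟨EuclideanSpace.single j 1, pattern_subset_iff.2 fun i hi => ?_, ?_⟩
    · have : i ≠ j := by rintro rfl; exact hi hj
      simp [this]
    · ext i
      simp [apply]
  | zero => exact ⟨0, pattern_subset_iff.2 fun _ _ => rfl, apply_zero Φ⟩
  | add u v _ _ hu hv =>
    obtain ⟨h, h1, h2⟩ := hu
    obtain ⟨h', h1', h2'⟩ := hv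
    refine ⟨h + h', pattern_subset_iff.2 fun j hj => ?_, by rw [apply_add, h2, h2']⟩
    simp [pattern_subset_iff.1 h1 j hj, pattern_subset_iff.1 h1' j hj]
  | smul a u _ hu =>
    obtain ⟨h, h1, h2⟩ := hu
    refine ⟨a • h, pattern_subset_iff.2 fun j hj => ?_, by rw [apply_smul, h2]⟩
    simp [pattern_subset_iff.1 h1 j hj]

theorem RIP.eq_zero_of_apply_eq_zero {Φ : Matrix (Fin m) (Fin n) ℝ} {s : ℕ} {δ : ℝ}
    (h : RIP Φ s δ) {v : EuclideanSpace ℝ (Fin n)} (hv : (pattern v).card ≤ s)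
    (h0 : apply Φ v = 0) : v = 0 := by
  have h1 := h.le_norm_apply hv
  rw [h0, norm_zero] at h1
  have h2 : 0 < √(1 - δ) := Real.sqrt_pos.2 (by linarith [h.2.1])
  exact norm_eq_zero.1 (le_antisymm (by nlinarith) (norm_nonneg _))

theorem RIP.finrank_columnSpan {Φ : Matrix (Fin m) (Fin n) ℝ} {s : ℕ} {δ : ℝ}
    (h : RIP Φ s δ) {S : Finset (Fin n)} (hS : S.card ≤ s) :
    Module.finrank ℝ (columnSpan Φ S) = S.card := by
  classical
  have hli : LinearIndependent ℝ fun j : S =>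
      (WithLp.toLp 2 (Φ.col j) : EuclideanSpace ℝ (Fin m)) := by
    rw [Fintype.linearIndependent_iff]
    intro g hg i
    set v : EuclideanSpace ℝ (Fin n) :=
      WithLp.toLp 2 fun j => if hj : j ∈ S then g ⟨j, hj⟩ else 0 with hv
    have hvS : pattern v ⊆ S := pattern_subset_iff.2 fun j hj => by simp [hv, hj]
    have hv0 : v = 0 := by
      refine h.eq_zero_of_apply_eq_zero ((Finset.card_le_card hvS).trans hS) ?_
      rw [← hg, apply_eq_sum, ← Finset.sum_subset S.subset_univ, ← Finset.sum_coe_sort S]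
      · exact Finset.sum_congr rfl fun j _ => by simp [hv]
      · intro j _ hj
        simp [hv, hj]
    have : v i = 0 := by rw [hv0]; rfl
    simpa [hv] using this
  rw [columnSpan, Set.image_eq_range]
  exact (finrank_span_eq_card hli).trans (by simp)

theorem norm_le_l1Norm (x : EuclideanSpace ℝ (Fin n)) : ‖x‖ ≤ l1Norm x := by
  have h := (EuclideanSpace.basisFun (Fin n) ℝ).sum_repr x
  calc ‖x‖ = ‖∑ j, (EuclideanSpace.basisFun (Fin n) ℝ).repr x j •
          EuclideanSpace.basisFun (Fin n) ℝ j‖ := by rw [h]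
    _ ≤ _ := norm_sum_le _ _
    _ = l1Norm x := Finset.sum_congr rfl fun j _ => by simp [norm_smul]

theorem continuous_l1Norm : Continuous (l1Norm (n := n)) := by
  unfold l1Norm
  fun_prop

theorem exists_isNoisyCSSolution (Φ : Matrix (Fin m) (Fin n) ℝ) (y : EuclideanSpace ℝ (Fin m))
    {ε : ℝ} (h : ∃ x, ‖y - apply Φ x‖ ≤ ε) : ∃ x, IsNoisyCSSolution Φ y ε x := by
  obtain ⟨x₀, hx₀⟩ := h
  have hcl : IsClosed {x | ‖y - apply Φ x‖ ≤ ε} :=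
    isClosed_le (continuous_const.sub (continuous_apply Φ)).norm continuous_const
  -- Competitors with `ℓ¹` norm at most that of `x₀` lie in this Euclidean ball, so minimizing over
  -- a compact set suffices.
  have hK := (isCompact_closedBall (0 : EuclideanSpace ℝ (Fin n)) (l1Norm x₀)).inter_right hcl
  obtain ⟨x, hx, hmin⟩ := hK.exists_isMinOn
    ⟨x₀, by simpa using norm_le_l1Norm x₀, hx₀⟩ continuous_l1Norm.continuousOn
  have hle : l1Norm x ≤ l1Norm x₀ := hmin ⟨by simpa using norm_le_l1Norm x₀, hx₀⟩
  refine ⟨x, hx.2, fun x' hx' => ?_⟩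
  rcases le_total (l1Norm x') (l1Norm x₀) with h1 | h1
  · exact hmin ⟨by simpa using (norm_le_l1Norm x').trans h1, hx'⟩
  · exact hle.trans h1

variable {k M : ℕ} {Φ : Matrix (Fin m) (Fin n) ℝ} {P N : ℝ}

theorem nonempty_decoder (c : Code m n k M Φ P) (hM : 0 < M) (N : ℝ) : Nonempty (Decoder c N) := by
  classical
  have hne : c.outer.Nonempty := ⟨_, c.pattern_mem ⟨0, hM⟩⟩
  have hcs : ∀ y, ∃ x, (∃ x, ‖y - apply Φ x‖ ≤ √(m * N)) → IsNoisyCSSolution Φ y √(m * N) x := by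
    intro y
    by_cases h : ∃ x, ‖y - apply Φ x‖ ≤ √(m * N)
    · obtain ⟨x, hx⟩ := exists_isNoisyCSSolution Φ y h
      exact ⟨x, fun _ => hx⟩
    · exact ⟨0, fun h' => absurd h' h⟩
  choose cs hcs using hcs
  have hdet : ∀ x : EuclideanSpace ℝ (Fin n), ∃ S ∈ c.outer, ∀ S' ∈ c.outer,
      (symmDiff (thresholdPattern c.τ x) S).card ≤
        (symmDiff (thresholdPattern c.τ x) S').card := fun x =>
    c.outer.exists_min_image _ hne
  choose det hdet1 hdet2 using hdet
  have hml : ∀ (S : Finset (Fin n)) (u : columnSpan Φ S), ∃ i₀ : Fin M,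
      (∃ i, pattern (c.x i) = S) → pattern (c.x i₀) = S ∧ ∀ i, pattern (c.x i) = S →
      likelihood (Module.finrank ℝ (columnSpan Φ S)) N
          (u : EuclideanSpace ℝ (Fin m)) (c.codeword i)
        ≤ likelihood (Module.finrank ℝ (columnSpan Φ S)) N
          (u : EuclideanSpace ℝ (Fin m)) (c.codeword i₀) := by
    intro S u
    by_cases h : ∃ i, pattern (c.x i) = S
    · obtain ⟨i, hi⟩ := h
      obtain ⟨i₀, h0, hmax⟩ := (Finset.univ.filter fun i => pattern (c.x i) = S).exists_max_image
        (fun i => likelihood (Module.finrank ℝ (columnSpan Φ S)) N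
          (u : EuclideanSpace ℝ (Fin m)) (c.codeword i)) ⟨i, by simpa using hi⟩
      exact ⟨i₀, fun _ => ⟨by simpa using h0, fun i' hi' => hmax i' (by simpa using hi')⟩⟩
    · exact ⟨⟨0, hM⟩, fun h' => absurd h' h⟩
  choose ml hml using hml
  exact ⟨⟨cs, hcs, det, hdet1, hdet2, ml, hml⟩⟩

variable {c : Code m n k M Φ P}

/-- Even a wrongly detected pattern belongs to the outer code, and by the RIP its `k` columns are
independent, so the dimension is always `k`. -/
theorem Decoder.complexity_eq (D : Decoder c N) {δ : ℝ} (h : RIP Φ k δ) (CXml : ℕ → ℕ)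
    (CXcs : ℕ → ℕ → ℕ) (y : EuclideanSpace ℝ (Fin m)) :
    D.complexity CXml CXcs y = CXml k + CXcs m n := by
  have hc := c.card_outer _ (D.detect_mem (D.cs y))
  change CXcs m n + CXml (Module.finrank ℝ (columnSpan Φ (D.detect (D.cs y)))) = _
  rw [h.finrank_columnSpan hc.le, hc, add_comm]

theorem norm_sub_le_of_likelihood_le {d : ℕ} (hN : 0 < N) {u w w' : EuclideanSpace ℝ (Fin m)}
    (h : likelihood d N u w ≤ likelihood d N u w') : ‖u - w'‖ ≤ ‖u - w‖ := by
  have hpos : 0 < (√(2 * Real.pi * N))⁻¹ ^ d := by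
    have := Real.pi_pos
    positivity
  unfold likelihood at h
  have h1 := Real.exp_le_exp.1 (le_of_mul_le_mul_left h hpos)
  rw [div_le_div_iff_of_pos_right (by positivity)] at h1
  exact le_of_sq_le_sq (by linarith) (norm_nonneg _)

/-- A misclassified coordinate contributes at least `τ ^ 2` to the squared error: off the pattern
`0` has become at least `τ`, on it a value of at least `2τ` has dropped below `τ`. -/
theorem card_symmDiff_thresholdPattern_le {x x' : EuclideanSpace ℝ (Fin n)} {τ d t : ℝ}
    (hτ : 0 < τ) (hx : ∀ j ∈ pattern x, 2 * τ ≤ |x j|) (hd : ‖x - x'‖ ≤ d)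
    (ht : d ^ 2 ≤ t * τ ^ 2) : ((symmDiff (thresholdPattern τ x') (pattern x)).card : ℝ) ≤ t := by
  set B := symmDiff (thresholdPattern τ x') (pattern x) with hB
  have hj : ∀ j ∈ B, τ ^ 2 ≤ (x - x') j ^ 2 := by
    intro j hj
    rw [sq_le_sq, abs_of_pos hτ, PiLp.sub_apply]
    rcases Finset.mem_symmDiff.1 hj with ⟨h1, h2⟩ | ⟨h1, h2⟩
    · have h1' : τ ≤ |x' j| := by simpa [thresholdPattern] using h1
      have h2' : x j = 0 := by simpa [pattern] using h2
      simpa [h2'] using h1'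
    · have h2' : |x' j| < τ := by simpa [thresholdPattern] using h2
      have := abs_sub_abs_le_abs_sub (x j) (x' j)
      linarith [hx j h1]
  have hsum : (B.card : ℝ) * τ ^ 2 ≤ ‖x - x'‖ ^ 2 := by
    rw [EuclideanSpace.norm_sq_eq]
    calc (B.card : ℝ) * τ ^ 2 = ∑ _j ∈ B, τ ^ 2 := by simp
      _ ≤ ∑ j ∈ B, (x - x') j ^ 2 := Finset.sum_le_sum hj
      _ ≤ ∑ j, (x - x') j ^ 2 :=
        Finset.sum_le_sum_of_subset_of_nonneg B.subset_univ fun _ _ _ => sq_nonneg _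
      _ = _ := Finset.sum_congr rfl fun j _ => by rw [Real.norm_eq_abs, sq_abs]
  have h2 : ‖x - x'‖ ^ 2 ≤ d ^ 2 := pow_le_pow_left₀ (norm_nonneg _) hd 2
  exact le_of_mul_le_mul_right (hsum.trans (h2.trans ht)) (by positivity)

/-- The noise inside the column span is absorbed into the sparse vector, and only the orthogonal
component has to meet the constraint of the program. It moves the vector by at most `ρ / √(1 - δ₄)`,
the second term of the deviation. -/
theorem Decoder.decode_eq (D : Decoder c N) {δ₃ δ₄ t ρ : ℝ} (hδ : δ₃ + 3 * δ₄ < 2)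
    (h3 : RIP Φ (3 * k) δ₃) (h4 : RIP Φ (4 * k) δ₄) (hN : 0 < N)
    (hτ : ∀ i, ∀ j ∈ pattern (c.x i), 2 * c.τ ≤ |c.x i j|)
    (houter : ∀ S ∈ c.outer, ∀ T ∈ c.outer, ((symmDiff S T).card : ℝ) ≤ 2 * t → S = T)
    (ht : (recoveryConst δ₃ δ₄ * √(m * N) + ρ / √(1 - δ₄)) ^ 2 ≤ t * c.τ ^ 2)
    (hsep : ∀ i i', pattern (c.x i) = pattern (c.x i') →
      ‖c.codeword i - c.codeword i'‖ ≤ 2 * ρ → i = i')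
    (i : Fin M) (z : EuclideanSpace ℝ (Fin m))
    (hz : ‖(columnSpan Φ (pattern (c.x i))).orthogonalProjectionOnto z‖ ≤ ρ)
    (hz' : ‖(columnSpan Φ (pattern (c.x i)))ᗮ.orthogonalProjectionOnto z‖ ≤ √(m * N)) :
    D.decode (c.codeword i + z) = i := by
  set S := pattern (c.x i) with hS
  set V := columnSpan Φ S with hV
  have hSk : S.card = k := c.card_outer _ (c.pattern_mem i)
  have hδ1 : 0 < √(1 - δ₄) := Real.sqrt_pos.2 (by linarith [h4.2.1])
  obtain ⟨h, hhS, hh⟩ := exists_apply_eq_of_mem_columnSpan (V.orthogonalProjectionOnto z).2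
  set y := c.codeword i + z with hy
  have hres : y - apply Φ (c.x i + h) = Vᗮ.orthogonalProjectionOnto z := by
    have h5 := V.starProjection_add_starProjection_orthogonal z
    simp only [Submodule.starProjection_apply] at h5
    rw [hy, apply_add, hh, Code.codeword]
    nth_rewrite 1 [← h5]
    abel
  have hfeas : ‖y - apply Φ (c.x i + h)‖ ≤ √(m * N) := by rw [hres]; exact hz'
  have hsupp : pattern (c.x i + h) ⊆ S := pattern_subset_iff.2 fun j hj => by
    simp [pattern_subset_iff.1 hhS j hj, pattern_subset_iff.1 hS.ge j hj]
  have hrec := norm_sub_le_of_isNoisyCSSolution hδ h3 h4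
    ((Finset.card_le_card hsupp).trans hSk.le) hfeas (D.cs_spec y ⟨_, hfeas⟩)
  have hhn : ‖h‖ ≤ ρ / √(1 - δ₄) := by
    rw [le_div_iff₀ hδ1, mul_comm]
    refine (h4.le_norm_apply ((Finset.card_le_card hhS).trans (by omega))).trans ?_
    rw [hh]; exact hz
  have hdist : ‖c.x i - D.cs y‖ ≤ recoveryConst δ₃ δ₄ * √(m * N) + ρ / √(1 - δ₄) := by
    have : c.x i - D.cs y = (c.x i + h - D.cs y) - h := by abel
    rw [this]
    exact (norm_sub_le _ _).trans (add_le_add hrec hhn)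
  have hcard := card_symmDiff_thresholdPattern_le c.τ_pos (hτ i) hdist ht
  have hdet : D.detect (D.cs y) = S := by
    refine houter _ (D.detect_mem _) _ (c.pattern_mem i) ?_
    have h5 := D.detect_spec (D.cs y) S (c.pattern_mem i)
    -- Triangle inequality through the thresholded set. The true pattern is within `t` of it and the
    -- detected one is no farther, so they differ in at most `2t` places.
    have h6 : (symmDiff (D.detect (D.cs y)) S).card ≤
        (symmDiff (thresholdPattern c.τ (D.cs y)) (D.detect (D.cs y))).card +
        (symmDiff (thresholdPattern c.τ (D.cs y)) S).card := by
      refine (Finset.card_le_card ?_).trans (Finset.card_union_le _ _)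
      have := symmDiff_triangle (D.detect (D.cs y)) (thresholdPattern c.τ (D.cs y)) S
      rw [symmDiff_comm (D.detect (D.cs y)) (thresholdPattern c.τ (D.cs y))] at this
      exact this
    have h7 : ((symmDiff (D.detect (D.cs y)) S).card : ℝ) ≤
        2 * (symmDiff (thresholdPattern c.τ (D.cs y)) S).card := by
      exact_mod_cast (by omega)
    linarith
  change D.ml (D.detect (D.cs y))
    ((columnSpan Φ (D.detect (D.cs y))).orthogonalProjectionOnto y) = i
  rw [hdet]
  obtain ⟨hp, hmax⟩ := D.ml_spec S (V.orthogonalProjectionOnto y) ⟨i, rfl⟩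
  have hle := norm_sub_le_of_likelihood_le hN (hmax i rfl)
  have hu : (V.orthogonalProjectionOnto y : EuclideanSpace ℝ (Fin m)) =
      c.codeword i + V.orthogonalProjectionOnto z := by
    rw [hy, map_add, Submodule.coe_add]
    congr 1
    have : c.codeword i ∈ V := apply_mem_columnSpan Φ subset_rfl
    exact Submodule.starProjection_eq_self_iff.2 this
  refine (hsep i _ hp.symm ?_).symm
  set w' := c.codeword (D.ml S (V.orthogonalProjectionOnto y))
  have h8 : ‖(V.orthogonalProjectionOnto y : EuclideanSpace ℝ (Fin m)) - c.codeword i‖ ≤ ρ := by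
    rw [hu, add_sub_cancel_left]; exact hz
  have h9 := norm_sub_le_norm_sub_add_norm_sub (c.codeword i)
    (V.orthogonalProjectionOnto y : EuclideanSpace ℝ (Fin m)) w'
  rw [norm_sub_rev (c.codeword i) (V.orthogonalProjectionOnto y : EuclideanSpace ℝ (Fin m))] at h9
  linarith

end Receiver

/-! ### Construction of the code and atypical noise -/

section Construction

variable {m n k : ℕ} {Φ : Matrix (Fin m) (Fin n) ℝ}

/-- The vector with prescribed coordinates in `S` that vanishes outside of `S`. -/
def extendByZero (S : Finset (Fin n)) : (S → ℝ) →ₗ[ℝ] EuclideanSpace ℝ (Fin n) where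
  toFun a := WithLp.toLp 2 fun j => if h : j ∈ S then a ⟨j, h⟩ else 0
  map_add' a b := by ext j; by_cases h : j ∈ S <;> simp [h]
  map_smul' t a := by ext j; by_cases h : j ∈ S <;> simp [h]

theorem extendByZero_apply_of_mem {S : Finset (Fin n)} (a : S → ℝ) {j : Fin n} (h : j ∈ S) :
    extendByZero S a j = a ⟨j, h⟩ := by simp [extendByZero, h]

theorem pattern_extendByZero_subset (S : Finset (Fin n)) (a : S → ℝ) :
    pattern (extendByZero S a) ⊆ S :=
  pattern_subset_iff.2 fun j hj => by simp [extendByZero, hj]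

theorem extendByZero_injective (S : Finset (Fin n)) : Function.Injective (extendByZero S) := by
  intro a b h
  ext j
  have := congrArg (fun v : EuclideanSpace ℝ (Fin n) => v j) h
  simpa only [extendByZero_apply_of_mem _ j.2] using this

theorem exists_pattern_packing {δ : ℝ} (h : RIP Φ k δ) {S : Finset (Fin n)} (hS : S.card = k)
    {a ρ r : ℝ} (ha : 0 < a) (hρ : 0 < ρ) (hr : 0 < r) {L : ℕ} (hL : (L : ℝ) < (ρ / r) ^ k + 1) :
    ∃ X : Finset (EuclideanSpace ℝ (Fin n)), X.card = L ∧
      (∀ x ∈ X, pattern x = S ∧ (∀ j ∈ S, a ≤ |x j|) ∧ ‖apply Φ x‖ ≤ ρ + √2 * (√k * a)) ∧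
      ∀ x ∈ X, ∀ y ∈ X, ‖apply Φ x - apply Φ y‖ ≤ r → x = y := by
  classical
  set T : (S → ℝ) →ₗ[ℝ] EuclideanSpace ℝ (Fin m) :=
    (Matrix.toEuclideanLin Φ) ∘ₗ extendByZero S with hTdef
  have hTa : ∀ v, T v = apply Φ (extendByZero S v) := fun v => rfl
  have hcard : ∀ v, (pattern (extendByZero S v)).card ≤ k := fun v =>
    (Finset.card_le_card (pattern_extendByZero_subset S v)).trans hS.le
  have hT : Function.Injective T := by
    rw [injective_iff_map_eq_zero]
    intro v hv
    exact extendByZero_injective S ((h.eq_zero_of_apply_eq_zero (hcard v) hv).trans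
      (map_zero _).symm)
  have hb : ∀ σ : S → ℝ, (∀ i, |σ i| = a) → ‖T σ‖ ≤ √2 * (√k * a) := by
    intro σ hσ
    rw [hTa]
    refine (h.norm_apply_le (hcard σ)).trans ?_
    have h1 : extendByZero S σ = restrictTo S (extendByZero S σ) := by
      ext j
      by_cases hj : j ∈ S <;> simp [extendByZero, hj]
    have h2 : ‖extendByZero S σ‖ ≤ √k * a := by
      rw [h1]
      refine norm_restrictTo_le hS.le ha.le fun j hj => ?_
      rw [extendByZero_apply_of_mem σ hj, hσ]
    have h3 : √(1 + δ) ≤ √2 := Real.sqrt_le_sqrt (by linarith [h.2.1])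
    gcongr
  have hSc : Fintype.card S = k := by simpa using hS
  obtain ⟨X, hXc, hX, hsep⟩ := exists_packing T hT ha.le hρ hr hb L (by rwa [hSc])
  refine ⟨X.map ⟨extendByZero S, extendByZero_injective S⟩, by simpa using hXc, ?_, ?_⟩
  · intro x hx
    obtain ⟨v, hv, rfl⟩ := Finset.mem_map.1 hx
    simp only [Function.Embedding.coeFn_mk]
    refine ⟨(pattern_extendByZero_subset S v).antisymm fun j hj => ?_, fun j hj => ?_,
      (hX v hv).2⟩
    · rw [mem_pattern, extendByZero_apply_of_mem v hj]
      exact abs_pos.1 (ha.trans_le ((hX v hv).1 _))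
    · rw [extendByZero_apply_of_mem v hj]
      exact (hX v hv).1 _
  · intro x hx y hy hle
    obtain ⟨v, hv, rfl⟩ := Finset.mem_map.1 hx
    obtain ⟨w, hw, rfl⟩ := Finset.mem_map.1 hy
    simp only [Function.Embedding.coeFn_mk] at hle ⊢
    rw [hsep v hv w hw (by rwa [map_sub])]

/-- Packings for different patterns are disjoint because a vector determines its pattern. The
messages are assigned to distinct elements of their union. -/
theorem exists_code {δ : ℝ} (h : RIP Φ k δ) (hm : 0 < m) {P : ℝ} (hP : 0 ≤ P)
    {C : Finset (Finset (Fin n))} (hC : ∀ S ∈ C, S.card = k) {τ ρ r : ℝ} (hτ : 0 < τ) (hρ : 0 < ρ)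
    (hr : 0 < r) (hpow : ρ + √2 * (√k * (2 * τ)) ≤ √(m * P)) {M : ℕ}
    (hM : M ≤ C.card * ⌈(ρ / r) ^ k⌉₊) :
    ∃ c : Code m n k M Φ P, c.outer = C ∧ c.τ = τ ∧
      (∀ i, ∀ j ∈ pattern (c.x i), 2 * c.τ ≤ |c.x i j|) ∧
      ∀ i i', pattern (c.x i) = pattern (c.x i') →
        ‖c.codeword i - c.codeword i'‖ ≤ r → i = i' := by
  classical
  have hex := fun (S : Finset (Fin n)) (hS : S ∈ C) =>
    exists_pattern_packing h (hC S hS) (a := 2 * τ) (by positivity) hρ hr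
      (Nat.ceil_lt_add_one (by positivity : 0 ≤ (ρ / r) ^ k))
  choose! X hXc hX hsep using hex
  set Y := C.biUnion X with hY
  have hYc : Y.card = C.card * ⌈(ρ / r) ^ k⌉₊ := by
    rw [hY, Finset.card_biUnion, Finset.sum_congr rfl hXc, Finset.sum_const, smul_eq_mul]
    intro S hS S' hS' hne
    refine Finset.disjoint_left.2 ?_
    intro x hx hx'
    exact hne ((hX S hS x hx).1.symm.trans (hX S' hS' x hx').1)
  have hMY : M ≤ Y.card := hM.trans hYc.ge
  set x : Fin M → EuclideanSpace ℝ (Fin n) := fun i => Y.equivFin.symm (Fin.castLE hMY i) with hx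
  have hxinj : Function.Injective x := fun i j hij => by
    simpa using Y.equivFin.symm.injective (Subtype.ext hij)
  have hxX : ∀ i, pattern (x i) ∈ C ∧ x i ∈ X (pattern (x i)) := fun i => by
    obtain ⟨S, hS, hxS⟩ := Finset.mem_biUnion.1 (Y.equivFin.symm (Fin.castLE hMY i)).2
    have : pattern (x i) = S := (hX S hS _ hxS).1
    rw [this]
    exact ⟨hS, hxS⟩
  refine ⟨⟨C, hC, x, fun i => (hxX i).1, fun i => ?_, τ, hτ⟩, rfl, rfl, fun i j hj => ?_,
    fun i i' hp hle => ?_⟩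
  · have h1 := ((hX _ (hxX i).1 _ (hxX i).2).2.2).trans hpow
    have h2 : ∑ j, apply Φ (x i) j ^ 2 = ‖apply Φ (x i)‖ ^ 2 := by
      rw [EuclideanSpace.norm_sq_eq]
      exact Finset.sum_congr rfl fun j _ => by rw [Real.norm_eq_abs, sq_abs]
    have h3 : ‖apply Φ (x i)‖ ^ 2 ≤ m * P := by
      rw [← Real.sq_sqrt (by positivity : 0 ≤ m * P)]
      exact pow_le_pow_left₀ (norm_nonneg _) h1 2
    have hm' : (0 : ℝ) < m := Nat.cast_pos.2 hm
    rw [h2, one_div, inv_mul_le_iff₀ hm']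
    exact h3
  · exact (hX _ (hxX i).1 _ (hxX i).2).2.1 j hj
  · refine hxinj (hsep _ (hxX i).1 _ (hxX i).2 _ ?_ hle)
    change pattern (x i) = pattern (x i') at hp
    rw [hp]
    exact (hxX i').2

theorem Decoder.errorProb_le {M : ℕ} {P N : ℝ} {c : Code m n k M Φ P} (D : Decoder c N)
    (hM : 0 < M) {η : ℝ}
    (h : ∀ i, (Measure.pi fun _ : Fin m => gaussianReal 0 N.toNNReal).real
      {z | D.decode (c.codeword i + WithLp.toLp 2 z) ≠ i} ≤ η) : D.errorProb ≤ η := by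
  have hM' : (0 : ℝ) < M := Nat.cast_pos.2 hM
  rw [errorProb, one_div, inv_mul_le_iff₀ hM']
  calc _ ≤ ∑ _i : Fin M, η := Finset.sum_le_sum fun i _ => h i
    _ = _ := by simp

/-- The probability that the noise has much energy in a `k`-dimensional subspace or in its
orthogonal complement. -/
theorem measure_atypical_noise_le (V : Submodule ℝ (EuclideanSpace ℝ (Fin m)))
    (hV : Module.finrank ℝ V = k) (hk : 0 < k) {N : ℝ} (hN : 0 < N) :
    (Measure.pi fun _ : Fin m => gaussianReal 0 N.toNNReal).real
      {z | ¬ (‖V.orthogonalProjectionOnto (WithLp.toLp 2 z)‖ ≤ √(11 / 10 * k * N) ∧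
        ‖Vᗮ.orthogonalProjectionOnto (WithLp.toLp 2 z)‖ ≤ √(m * N))} ≤
      101 * chiSquareVar * m / k ^ 2 := by
  have hk' : (0 : ℝ) < k := Nat.cast_pos.2 hk
  have hv := chiSquareVar_nonneg
  have hdim := V.finrank_add_finrank_orthogonal
  rw [hV, finrank_euclideanSpace_fin] at hdim
  have hdim' : (Module.finrank ℝ Vᗮ : ℝ) = m - k := by
    have : (k : ℝ) + Module.finrank ℝ Vᗮ = m := by exact_mod_cast hdim
    linarith
  -- In `V` the margin `k/10` gives the energy level `11/10 * k * N`. In `Vᗮ`, of dimension `m - k`,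
  -- the margin `k` leads up to exactly `m * N`.
  have h1 := measure_norm_projection_sq_ge_le V hN (c := k / 10) (by positivity)
  have h2 := measure_norm_projection_sq_ge_le Vᗮ hN hk'
  rw [hV] at h1
  have hkm : (k : ℝ) ≤ m := by
    have : k ≤ m := by omega
    exact_mod_cast this
  rw [hdim'] at h2
  rw [Measure.real]
  refine ENNReal.toReal_le_of_le_ofReal (by positivity) ?_
  refine (measure_mono (fun z hz => ?_)).trans ((measure_union_le _ _).trans
    ((add_le_add h1 h2).trans ?_))
  · simp only [Set.mem_ofPred_eq, not_and_or, not_le] at hz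
    simp only [Set.mem_union, Set.mem_ofPred_eq]
    rcases hz with hz | hz
    · left
      have := (Real.sqrt_lt' ((Real.sqrt_nonneg _).trans_lt hz)).1 hz
      refine le_trans (le_of_eq ?_) this.le
      ring
    · right
      have := (Real.sqrt_lt' ((Real.sqrt_nonneg _).trans_lt hz)).1 hz
      refine le_trans (le_of_eq ?_) this.le
      ring
  · have hmk : (0 : ℝ) ≤ m - k := sub_nonneg.2 hkm
    rw [← ENNReal.ofReal_add (by positivity) (by positivity)]
    refine ENNReal.ofReal_le_ofReal ?_
    have h3 : (k : ℝ) * chiSquareVar / (k / 10) ^ 2 = 100 * (k * chiSquareVar) / k ^ 2 := by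
      field_simp; norm_num
    rw [h3, ← add_div]
    gcongr
    nlinarith [mul_le_mul_of_nonneg_left hkm hv, mul_nonneg hk'.le hv]

end Construction

/-! ### Counting messages against the available codewords -/

section Rates

/-- The number of messages, compared with a product of a binomial coefficient and a power. -/
theorem two_rpow_sparseRate_le {m n k : ℕ} (hm : 0 < m) (hk : 0 < k) (hkn : k < n)
    {P N δ β : ℝ} (hPN : 0 < P / N) (hβ : 2 ≤ β * (1 + δ)) :
    (2 : ℝ) ^ ((m : ℝ) * sparseRate m n k P N δ β) ≤
      √((1 + P / N) / 2) ^ k * ((n + 1) * n.choose k) := by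
  have hm' : (m : ℝ) ≠ 0 := Nat.cast_ne_zero.2 hm.ne'
  have hk' : (0 : ℝ) < k := Nat.cast_pos.2 hk
  -- The loss of half a bit per active coordinate becomes the factor `1/2` under the root.
  have h1 : Real.logb 2 (1 / (β * (1 + δ))) ≤ -1 := by
    rw [one_div, Real.logb_inv]
    have := Real.logb_le_logb_of_le one_lt_two two_pos hβ
    rw [Real.logb_self_eq_one one_lt_two] at this
    linarith
  have hB : Real.logb 2 √((1 + P / N) / 2) = capacity P N - 1 / 2 := by
    rw [Real.sqrt_eq_rpow, Real.logb_rpow_eq_mul_logb_of_pos (by positivity),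
      Real.logb_div (by positivity) two_ne_zero, Real.logb_self_eq_one one_lt_two, capacity]
    ring
  have h2 : (m : ℝ) * sparseRate m n k P N δ β ≤
      k * Real.logb 2 √((1 + P / N) / 2) + n * binaryEntropy ((k : ℝ) / n) := by
    have h3 : (m : ℝ) * sparseRate m n k P N δ β = k * capacity P N
        + n * binaryEntropy ((k : ℝ) / n) + k / 2 * Real.logb 2 (1 / (β * (1 + δ))) := by
      rw [sparseRate]; field_simp
    rw [h3, hB]
    nlinarith
  calc _ ≤ (2 : ℝ) ^ (k * Real.logb 2 √((1 + P / N) / 2) + n * binaryEntropy ((k : ℝ) / n)) :=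
        Real.rpow_le_rpow_of_exponent_le one_le_two h2
    _ = √((1 + P / N) / 2) ^ k * (2 : ℝ) ^ ((n : ℝ) * binaryEntropy ((k : ℝ) / n)) := by
        rw [Real.rpow_add two_pos, mul_comm (k : ℝ), Real.rpow_mul two_pos.le,
          Real.rpow_logb two_pos (by norm_num) (by positivity), Real.rpow_natCast]
    _ ≤ _ := by gcongr; exact two_rpow_entropy_le hk hkn

/-- The Chernoff bound with `lam = α₀/20`: each of its two factors is at most `exp (k/20)`, and `exp
(1/10) ≤ 10/9`. -/
theorem card_small_subsets_le_pow {n k : ℕ} {α₀ t : ℝ} (hα₀ : 0 < α₀) (hα₁ : α₀ ≤ 1)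
    (hn : 0 < n) (hk : α₀ ≤ (k : ℝ) / n) (ht : t * Real.log (20 / α₀) ≤ k / 20) :
    ((Finset.univ.filter fun S : Finset (Fin n) => (S.card : ℝ) ≤ t).card : ℝ) ≤
      (10 / 9) ^ k := by
  have hn' : (0 : ℝ) < n := Nat.cast_pos.2 hn
  rw [le_div_iff₀ hn'] at hk
  have hl : 0 < α₀ / 20 := by positivity
  have h1 : (α₀ / 20) ^ (-t) ≤ Real.exp (k / 20) := by
    rw [Real.rpow_def_of_pos hl]
    refine Real.exp_le_exp.2 ?_
    rw [← inv_div, Real.log_inv] at ht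
    linarith
  have h2 : (1 + α₀ / 20) ^ n ≤ Real.exp (k / 20) := by
    calc (1 + α₀ / 20) ^ n ≤ Real.exp (α₀ / 20) ^ n := by
          gcongr
          rw [add_comm]
          exact Real.add_one_le_exp _
      _ = Real.exp (n * (α₀ / 20)) := (Real.exp_nat_mul _ _).symm
      _ ≤ _ := Real.exp_le_exp.2 (by linarith)
  have h3 : Real.exp (1 / 10) ≤ 10 / 9 := by
    have h4 := Real.add_one_le_exp (-(1 / 10) : ℝ)
    rw [Real.exp_neg] at h4
    have h5 : (9 : ℝ) / 10 ≤ (Real.exp (1 / 10))⁻¹ := by linarith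
    rw [le_inv_comm₀ (by norm_num) (Real.exp_pos _)] at h5
    linarith
  calc _ ≤ (α₀ / 20) ^ (-t) * (1 + α₀ / 20) ^ n := card_small_subsets_le n hl (by linarith)
    _ ≤ Real.exp (k / 20) * Real.exp (k / 20) := by gcongr
    _ = Real.exp (1 / 10) ^ k := by
        rw [← Real.exp_add, ← Real.exp_nat_mul]; congr 1; ring
    _ ≤ _ := by gcongr

/-- Outer codes: separated, large, and everything when the required separation is trivial. -/
theorem exists_outer_code {n k : ℕ} {α₀ t : ℝ} (hα₀ : 0 < α₀) (hα₁ : α₀ ≤ 1)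
    (hn : 0 < n) (hk : α₀ ≤ (k : ℝ) / n) (ht0 : 0 ≤ t)
    (ht : t * Real.log (20 / α₀) ≤ k / 20) :
    ∃ C : Finset (Finset (Fin n)), (∀ S ∈ C, S.card = k) ∧
      (t < 1 → C = Finset.univ.powersetCard k) ∧
      (∀ S ∈ C, ∀ T ∈ C, ((symmDiff S T).card : ℝ) ≤ t → S = T) ∧
      (n.choose k : ℝ) ≤ C.card * (10 / 9) ^ k := by
  by_cases h : t < 1
  · refine ⟨Finset.univ.powersetCard k, fun S hS => (Finset.mem_powersetCard.1 hS).2,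
      fun _ => rfl, fun S _ T _ hle => ?_, ?_⟩
    · have h1 : (symmDiff S T).card < 1 := by exact_mod_cast hle.trans_lt h
      have h2 : symmDiff S T = ∅ := Finset.card_eq_zero.1 (by omega)
      exact symmDiff_eq_bot.1 h2
    · simp only [Finset.card_powersetCard, Finset.card_univ, Fintype.card_fin]
      exact le_mul_of_one_le_right (Nat.cast_nonneg _) (one_le_pow₀ (by norm_num))
  · obtain ⟨C, hC, hsep, hcard⟩ := exists_separated_patterns n k ht0
    refine ⟨C, fun S hS => (Finset.mem_powersetCard.1 (hC hS)).2, fun h' => absurd h' h, hsep, ?_⟩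
    calc (n.choose k : ℝ) ≤ C.card *
          (Finset.univ.filter fun S : Finset (Fin n) => (S.card : ℝ) ≤ t).card := by
          exact_mod_cast hcard
      _ ≤ _ := by gcongr; exact card_small_subsets_le_pow hα₀ hα₁ hn hk ht

/-- Since `n ≤ k/α₀`, this compares a linear with an exponential function of `k`. It absorbs the
polynomial factor of the entropy bound. -/
theorem exists_succ_le_pow {α₀ : ℝ} (hα₀ : 0 < α₀) :
    ∃ n₀ : ℕ, ∀ n k : ℕ, n₀ ≤ n → α₀ * n ≤ k → (n : ℝ) + 1 ≤ (27 / 25) ^ k := by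
  have hlim : Filter.Tendsto (fun k : ℕ => ((k : ℝ) / α₀ + 1) / (27 / 25) ^ k) Filter.atTop
      (nhds 0) := by
    have h1 := tendsto_pow_const_div_const_pow_of_one_lt 1 (by norm_num : (1 : ℝ) < 27 / 25)
    have h0 := tendsto_pow_const_div_const_pow_of_one_lt 0 (by norm_num : (1 : ℝ) < 27 / 25)
    have h := (h1.const_mul α₀⁻¹).add h0
    rw [mul_zero, add_zero] at h
    refine h.congr fun k => ?_
    simp only [pow_one, pow_zero]
    ring
  obtain ⟨K, hK⟩ := Filter.eventually_atTop.1 (hlim.eventually_lt_const one_pos)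
  obtain ⟨n₀, hn₀⟩ := exists_nat_ge ((K : ℝ) / α₀)
  refine ⟨n₀, fun n k hn hk => ?_⟩
  have h1 : (K : ℝ) ≤ k := by
    rw [div_le_iff₀ hα₀] at hn₀
    have : (n₀ : ℝ) ≤ n := by exact_mod_cast hn
    nlinarith
  have h2 := hK k (by exact_mod_cast h1)
  rw [div_lt_one (by positivity)] at h2
  have h3 : (n : ℝ) ≤ k / α₀ := by rw [le_div_iff₀ hα₀]; linarith
  linarith

/-- Squared and with `x = P/N`, the left side is `0.72 (1 + x)` and, by `4k ≤ m`, the right side is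
at least `0.82 x`. -/
theorem packing_ratio_ge {m k : ℕ} (hk : 0 < k) (hkm : 4 * k ≤ m) {P N : ℝ} (hP : 0 < P)
    (hN : 0 < N) (hsnr : 100 ≤ P / N) :
    6 / 5 * √((1 + P / N) / 2) ≤ 19 / 20 * √(m * P) / (2 * √(11 / 10 * k * N)) := by
  have hk' : (0 : ℝ) < k := Nat.cast_pos.2 hk
  have hkm' : 4 * (k : ℝ) ≤ m := by exact_mod_cast hkm
  have hm' : (0 : ℝ) < m := by linarith
  refine le_of_sq_le_sq ?_ (by positivity)
  rw [div_pow, mul_pow, mul_pow, mul_pow, Real.sq_sqrt (by positivity),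
    Real.sq_sqrt (by positivity), Real.sq_sqrt (by positivity), le_div_iff₀ (by positivity)]
  have hx : P = P / N * N := by field_simp
  set x := P / N
  have h1 : 4 * (k : ℝ) * (x * N) ≤ m * (x * N) := by gcongr
  have h2 : 100 * (k * N) ≤ x * (k * N) := by gcongr
  rw [hx]
  nlinarith [mul_pos hk' hN]

end Rates

/-! ### Choice of parameters and conclusion -/

section Achievability

/-- Each active coordinate can afford a factor `6/5 = 27/25 * 10/9`: the first part covers `n + 1`,
the second the thinning of the patterns. -/
theorem numMessages_le {m n k : ℕ} (hm : 0 < m) (hk : 0 < k) (hkn : k < n) (hkm : 4 * k ≤ m)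
    {P N δ β : ℝ} (hP : 0 < P) (hN : 0 < N) (hsnr : 100 ≤ P / N) (hβ : 2 ≤ β * (1 + δ))
    {K : ℕ} (hK : (n.choose k : ℝ) ≤ K * (10 / 9) ^ k) (hn : (n : ℝ) + 1 ≤ (27 / 25) ^ k) :
    numMessages m (sparseRate m n k P N δ β) ≤
      K * ⌈(19 / 20 * √(m * P) / (2 * √(11 / 10 * k * N))) ^ k⌉₊ := by
  rw [numMessages, Nat.ceil_le]
  have hPN : 0 < P / N := div_pos hP hN
  set B := √((1 + P / N) / 2) with hB
  have hratio := packing_ratio_ge hk hkm hP hN hsnr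
  rw [← hB] at hratio
  set q := 19 / 20 * √(m * P) / (2 * √(11 / 10 * k * N)) with hq
  calc _ ≤ B ^ k * ((n + 1) * n.choose k) := two_rpow_sparseRate_le hm hk hkn hPN hβ
    _ ≤ B ^ k * ((27 / 25) ^ k * (K * (10 / 9) ^ k)) := by gcongr
    _ = K * (6 / 5 * B) ^ k := by
        rw [mul_pow, show (6 / 5 : ℝ) = 27 / 25 * (10 / 9) by norm_num, mul_pow]; ring
    _ ≤ K * q ^ k := by gcongr
    _ ≤ _ := by push_cast; gcongr; exact Nat.le_ceil _

/-- The bound on the distance of the sent vector and the solution of the program, in units of the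
noise level. -/
noncomputable def deviationConst (δ₃ δ₄ : ℝ) : ℝ := recoveryConst δ₃ δ₄ + 1 / √(1 - δ₄)

theorem deviationConst_nonneg {δ₃ δ₄ : ℝ} (hδ₃ : 0 < δ₃) (hδ : δ₃ + 3 * δ₄ < 2) :
    0 ≤ deviationConst δ₃ δ₄ := by
  have := recoveryConst_pos hδ₃ hδ
  unfold deviationConst
  positivity

theorem exists_code_decoder {δ₃ δ₄ α₀ ε : ℝ} (hδ : δ₃ + 3 * δ₄ < 2) (hα₀ : 0 < α₀)
    {m n k : ℕ} {Φ : Matrix (Fin m) (Fin n) ℝ} {δ β P N : ℝ}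
    (hm : 0 < m) (hmn : m ≤ n) (hkn : 4 * k ≤ n) (hα : α₀ ≤ (k : ℝ) / n)
    (hlarge : (n : ℝ) + 1 ≤ (27 / 25) ^ k) (hε : 101 * chiSquareVar / α₀ ^ 2 ≤ ε * m)
    (h : RIP Φ k δ) (h3 : RIP Φ (3 * k) δ₃) (h4 : RIP Φ (4 * k) δ₄)
    (hβ : IsNoiseConstant Φ k β) (hP : 0 < P) (hN : 0 < N) (hsnr : 100 ≤ P / N)
    (hsnr' : 128000 * deviationConst δ₃ δ₄ ^ 2 * Real.log (20 / α₀) ≤ P / N) :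
    ∃ c : Code m n k (numMessages m (sparseRate m n k P N δ β)) Φ P,
      ((3200 * deviationConst δ₃ δ₄ ^ 2 + 1) * m ≤ P / N →
        c.outer = Finset.univ.powersetCard k) ∧
      Nonempty (Decoder c N) ∧ ∀ D : Decoder c N,
        (∀ (CXml : ℕ → ℕ) (CXcs : ℕ → ℕ → ℕ) (y : EuclideanSpace ℝ (Fin m)),
          D.complexity CXml CXcs y = CXml k + CXcs m n) ∧ D.errorProb ≤ ε := by
  have hn : 0 < n := hm.trans_le hmn
  have hn' : (0 : ℝ) < n := Nat.cast_pos.2 hn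
  have hm' : (0 : ℝ) < m := Nat.cast_pos.2 hm
  have hmn' : (m : ℝ) ≤ n := Nat.cast_le.2 hmn
  have hkα : α₀ * n ≤ k := by rwa [le_div_iff₀ hn'] at hα
  have hk' : (0 : ℝ) < k := by nlinarith
  have hk : 0 < k := Nat.cast_pos.1 hk'
  have hkm : 4 * k ≤ m := h4.le_rows hkn
  have hkm' : 4 * (k : ℝ) ≤ m := by exact_mod_cast hkm
  have hα₁ : α₀ ≤ 1 := by
    refine hα.trans ((div_le_one hn').2 ?_)
    linarith
  have hPN : 0 < P / N := div_pos hP hN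
  have hD := deviationConst_nonneg h3.1 hδ
  set D₀ := deviationConst δ₃ δ₄ with hD₀
  -- Chosen so that `t * τ ^ 2 = D₀ ^ 2 * (m * N)`, the square of the deviation bound; here `τ ^ 2 =
  -- m * P / (3200 * k)`.
  set t := 3200 * D₀ ^ 2 * k / (P / N) with ht
  have ht0 : 0 ≤ t := by positivity
  have htlog : 2 * t * Real.log (20 / α₀) ≤ k / 20 := by
    rw [ht, show 2 * (3200 * D₀ ^ 2 * k / (P / N)) * Real.log (20 / α₀) =
      128000 * D₀ ^ 2 * Real.log (20 / α₀) * (k / 20) / (P / N) by ring, div_le_iff₀ hPN,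
      mul_comm (k / 20 : ℝ)]
    gcongr
  obtain ⟨C, hC, hCall, hCsep, hCcard⟩ :=
    exists_outer_code (k := k) (t := 2 * t) hα₀ hα₁ hn hα (by positivity) htlog
  -- Forcing coordinates up to `2τ` then costs exactly `√(m * P) / 20`, the share of the radius left
  -- free by the factor `19/20`.
  set τ := √(m * P) / (40 * (√2 * √k)) with hτ
  have hτ0 : 0 < τ := by positivity
  have hpow : 19 / 20 * √(m * P) + √2 * (√k * (2 * τ)) ≤ √(m * P) := by
    have : √2 * (√k * (2 * τ)) = √(m * P) / 20 := by
      rw [hτ]; field_simp; norm_num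
    rw [this]; linarith
  set ρ := √(11 / 10 * k * N) with hρ
  have hρ0 : 0 < ρ := by positivity
  have hM : 0 < numMessages m (sparseRate m n k P N δ β) := Nat.ceil_pos.2 (by positivity)
  obtain ⟨c, hcC, hcτ, hcx, hcsep⟩ := exists_code h hm hP.le hC hτ0 (by positivity)
    (by positivity) hpow (numMessages_le hm hk (by omega) hkm hP hN hsnr (hβ.two_le h hk hn)
      hCcard hlarge)
  refine ⟨c, fun hs => ?_, nonempty_decoder c hM N, fun D => ⟨D.complexity_eq h, ?_⟩⟩
  · rw [hcC]
    refine hCall ?_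
    -- At this signal-to-noise ratio `2 * t < 1`: no coordinate is misclassified, and distinct
    -- patterns need no further separation.
    have h5 : t ≤ 1 / 4 := by
      rw [ht, div_le_iff₀ hPN]
      have h6 : D₀ ^ 2 * (4 * k) ≤ D₀ ^ 2 * m := by gcongr
      nlinarith
    linarith
  · refine D.errorProb_le hM fun i => ?_
    have hbound : (recoveryConst δ₃ δ₄ * √(m * N) + ρ / √(1 - δ₄)) ^ 2 ≤ t * c.τ ^ 2 := by
      have h5 : ρ ≤ √(m * N) := Real.sqrt_le_sqrt (by gcongr; linarith)
      have hR := recoveryConst_pos h3.1 hδ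
      calc _ ≤ (D₀ * √(m * N)) ^ 2 := by
            gcongr
            rw [hD₀, deviationConst, add_mul, one_div_mul_eq_div]
            gcongr
        _ = t * c.τ ^ 2 := by
            rw [hcτ, hτ, ht, div_pow, mul_pow, mul_pow, mul_pow, Real.sq_sqrt (by positivity),
              Real.sq_sqrt (by positivity), Real.sq_sqrt (by positivity),
              Real.sq_sqrt (by positivity)]
            field_simp
            ring
    have hdec := fun z : Fin m → ℝ =>
      D.decode_eq hδ h3 h4 hN hcx (by rwa [hcC]) hbound hcsep i (WithLp.toLp 2 z)
    have hdim : Module.finrank ℝ (columnSpan Φ (pattern (c.x i))) = k := by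
      have h5 := c.card_outer _ (c.pattern_mem i)
      rw [h.finrank_columnSpan h5.le, h5]
    refine le_trans (measureReal_mono (fun z hz => ?_) (measure_ne_top _ _))
      ((measure_atypical_noise_le _ hdim hk hN).trans ?_)
    · simp only [Set.mem_ofPred_eq] at hz ⊢
      exact fun hcon => hz (hdec z hcon.1 hcon.2)
    -- As `k ≥ α₀ * n ≥ α₀ * m`, the Chebyshev bound is of order `1/m`.
    · have h5 : (α₀ * m) ^ 2 ≤ (k : ℝ) ^ 2 := by
        have : α₀ * m ≤ α₀ * n := by gcongr
        exact pow_le_pow_left₀ (by positivity) (this.trans hkα) 2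
      have hv := chiSquareVar_nonneg
      calc 101 * chiSquareVar * m / (k : ℝ) ^ 2 ≤ 101 * chiSquareVar * m / (α₀ * m) ^ 2 := by
            gcongr
        _ = 101 * chiSquareVar / α₀ ^ 2 / m := by field_simp
        _ ≤ ε := by rwa [div_le_iff₀ hm']

end Achievability

end SparseChannel

theorem theorem3 (δ₃ δ₄ : ℝ) (hδ₃ : δ₃ ∈ Set.Ioo (0 : ℝ) 1) (hδ₄ : δ₄ ∈ Set.Ioo (0 : ℝ) 1)
    (hδ : δ₃ + 3 * δ₄ < 2) :
    (∃ β₀ : ℝ, ∀ (m n k : ℕ) (Φ : Matrix (Fin m) (Fin n) ℝ),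
      SparseChannel.RIP Φ (3 * k) δ₃ → SparseChannel.RIP Φ (4 * k) δ₄ →
        SparseChannel.IsNoiseConstant Φ k β₀) ∧
    ∀ α₀ : ℝ, 0 < α₀ → ∃ snr₀ snr₁ : ℝ, ∀ ε : ℝ, 0 < ε → ∃ m₀ : ℕ,
      ∀ (m n k : ℕ) (Φ : Matrix (Fin m) (Fin n) ℝ) (δ β P N : ℝ),
        m₀ ≤ m → m ≤ n → 4 * k ≤ n → α₀ ≤ (k : ℝ) / n →
        SparseChannel.RIP Φ k δ → SparseChannel.RIP Φ (3 * k) δ₃ →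
        SparseChannel.RIP Φ (4 * k) δ₄ → SparseChannel.IsNoiseConstant Φ k β →
        0 < P → 0 < N → snr₀ ≤ P / N →
        ∃ c : SparseChannel.Code m n k
            (SparseChannel.numMessages m (SparseChannel.sparseRate m n k P N δ β)) Φ P,
          (snr₁ * m ≤ P / N → c.outer = Finset.univ.powersetCard k) ∧
          Nonempty (SparseChannel.Decoder c N) ∧
          ∀ D : SparseChannel.Decoder c N,
            (∀ (CXml : ℕ → ℕ) (CXcs : ℕ → ℕ → ℕ) (y : EuclideanSpace ℝ (Fin m)),
              D.complexity CXml CXcs y = CXml k + CXcs m n) ∧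
            D.errorProb ≤ ε := by
  refine ⟨⟨SparseChannel.recoveryConst δ₃ δ₄, fun m n k Φ h3 h4 =>
    SparseChannel.isNoiseConstant_recoveryConst hδ h3 h4⟩, fun α₀ hα₀ => ?_⟩
  -- The value 100 serves the packing ratio. The other bound keeps the separation `2 * t` small
  -- enough for the outer code, with `128000 = 3200 * 2 * 20`.
  refine ⟨max 100 (128000 * SparseChannel.deviationConst δ₃ δ₄ ^ 2 * Real.log (20 / α₀)),
    3200 * SparseChannel.deviationConst δ₃ δ₄ ^ 2 + 1, fun ε hε => ?_⟩
  obtain ⟨n₀, hn₀⟩ := SparseChannel.exists_succ_le_pow hα₀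
  obtain ⟨m₁, hm₁⟩ := exists_nat_ge (101 * SparseChannel.chiSquareVar / α₀ ^ 2 / ε)
  -- Here `n₀` absorbs the factor `n + 1`, `m₁` makes the error probability small, and `1` ensures
  -- `0 < m`.
  refine ⟨max (max n₀ m₁) 1, fun m n k Φ δ β P N hm hmn hkn hα h h3 h4 hβ hP hN hsnr => ?_⟩
  simp only [max_le_iff] at hm hsnr
  have hn : (0 : ℝ) < n := Nat.cast_pos.2 (by omega)
  refine SparseChannel.exists_code_decoder hδ hα₀ (by omega) hmn hkn hα
    (hn₀ n k (hm.1.1.trans hmn) (by rwa [le_div_iff₀ hn] at hα)) ?_ h h3 h4 hβ hP hN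
    hsnr.1 hsnr.2
  rw [div_le_iff₀ hε] at hm₁
  have : (m₁ : ℝ) ≤ m := by exact_mod_cast hm.1.2
  rw [mul_comm ε]
  exact hm₁.trans (by gcongr)
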